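/- Consider finite hypergraphs $H=(V,E)$ ($E$ a set of subsets of $V$). For $S\subseteq V$ and $e\in E$ put $\mathrm{sat}(e)=|e\cap S|$. A set $S\subseteq V$ is a $k$-weak independent set if $|e\cap S|\le k$ for all $e\in E$, and a $k$-weak maximal independent set ($k$-weak MIS) if in addition no proper superset of $S$ is a $k$-weak independent set. Let $\log$ denote the base-2 logarithm, and let $\log^* x$ be the number of times $\log$ has to be applied to $x$ until the result is at most $1$. Algorithm kWeakMIS, with parameters $\Delta,r,k$ where $1\le k\le r-1$, is the following. Start with $S=\varnothing$ and the set $A=V$ of active vertices. For each iteration $i=1,2,\dots,1+\lfloor\Delta\log r\rfloor$: (1) For each edge $e$ let $A_e=A\cap e$. If $|A_e|\ge 4(r-k)$, partition $A_e$ into $\lfloor |A_e|/4\rfloor$ nonempty parts of size at most $5$ (into $\lfloor |A_e|/4\rfloor+1$ such parts if $|A_e|\in\{6,7,11\}$); otherwise keep $A_e$ as a single part. (2) Let $H'$ be the hypergraph on $A$ whose edges are all these parts, and colour $A$ properly with $4\Delta(r-k)+1$ colours, i.e. so that distinct vertices in a common part get distinct colours. (3) For each colour $c$ in increasing order, with $V_c\subseteq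 A$ the set of vertices of colour $c$: simultaneously, every $v\in V_c$ such that $|V_c\cap e|\le k-\mathrm{sat}(e)$ for every edge $e\ni v$ is added to $S$. (4) Remove from $A$ all vertices of $S$ and all vertices that lie in an edge $e$ with $\mathrm{sat}(e)=k$. The output is the final set $S$. (The partitions in (1) and the colourings in (2) may be chosen arbitrarily.) Theorem. Let $1\le k\le r-1$ and $\Delta\ge 0$ be integers. (a) If $H$ is an $r$-uniform hypergraph of maximum degree at most $\Delta$, then every execution of kWeakMIS on $H$ outputs a $k$-weak MIS of $H$. (b) kWeakMIS can be carried out in $O(\Delta^2(r-k)\log r+\Delta\log r\,\log^* r+\log^* n)$ rounds of the LOCAL model. Precisely: for every $c\in\mathbb N$ there are a deterministic LOCAL algorithm and a constant $C$, depending only on $c$, such that on every $n$-vertex $r$-uniform hypergraph $H$ of maximum degree at most $\Delta$ whose vertices carry distinct identifiers from $\{0,1,\dots,n^c\}$, where every vertex initially knows $n,\Delta,r,k$, its own identifier and its incident edges (as sets of identifiers), the algorithm stops after at most $C\,(\Delta^2(r-k)\log r+\Delta\log r\,\log^* r+\log^* n)$ rounds, and the set of vertices that output "true" is the output of an execution of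 kWeakMIS on $H$; in particular it is a $k$-weak MIS of $H$. In every round each vertex sends a message of arbitrary size to each neighbour (each other vertex with which it shares an edge), and local computation is unrestricted. -/

import Mathlib

namespace WeakMIS

universe u

noncomputable section

open scoped Classical

/-! ## Iterated logarithm -/

/-- `log* x`: the number of times the base-2 logarithm has to be applied to `x` before the result is
at most `1`. -/
def logStar (x : ℝ) : ℕ := sInf {i : ℕ | (Real.logb 2)^[i] x ≤ 1}

/-! ## Finite hypergraphs and weak independent sets -/

section Hypergraphs

variable {V : Type u} [Fintype V] [DecidableEq V]

/-- The edges of a hypergraph on a finite vertex type, as a finset of finsets. -/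
def edges (H : Hypergraph V) : Finset (Finset V) :=
  Finset.univ.filter fun e => (e : Set V) ∈ H.edgeSet

/-- The edges that contain the vertex `v`. -/
def incidentEdges (H : Hypergraph V) (v : V) : Finset (Finset V) :=
  (edges H).filter fun e => v ∈ e

/-- Every edge has exactly `r` vertices. -/
def IsUniform (H : Hypergraph V) (r : ℕ) : Prop := ∀ e ∈ edges H, e.card = r

/-- Every vertex lies in at most `Δ` edges. -/
def MaxDegreeLE (H : Hypergraph V) (Δ : ℕ) : Prop := ∀ v, (incidentEdges H v).card ≤ Δ

/-- The saturation `|e ∩ S|` of the edge `e` with respect to `S`. -/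
def sat (S e : Finset V) : ℕ := (e ∩ S).card

/-- `S` is a `k`-weak independent set: no edge contains more than `k` vertices of `S`. -/
def IsKWeakIS (H : Hypergraph V) (k : ℕ) (S : Finset V) : Prop :=
  ∀ e ∈ edges H, (e ∩ S).card ≤ k

/-- `S` is a `k`-weak maximal independent set: it is a `k`-weak independent set, and no proper
superset of it is one. -/
def IsKWeakMIS (H : Hypergraph V) (k : ℕ) (S : Finset V) : Prop :=
  Maximal (IsKWeakIS H k) S

/-- A map `f` is a proper (valid) colouring of the hypergraph `H`: distinct vertices that lie in a
common edge get distinct colours. -/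
def IsProperColoring {α : Type*} (H : Hypergraph V) (f : V → α) : Prop :=
  ∀ u v, u ≠ v → H.Adj u v → f u ≠ f v

/-! ## The algorithm kWeakMIS -/

/-- The number of parts into which a set of `a` active vertices is split: `⌊a / 4⌋`, or one more
if `⌊a / 4⌋` parts of size at most `5` cannot cover `a` vertices
(for `a ≥ 4` this happens exactly when `a` is `6`, `7` or `11`). -/
def numParts (a : ℕ) : ℕ := if 5 * (a / 4) < a then a / 4 + 1 else a / 4

/-- `P` is an admissible partition of the set `Ae` of active vertices of an edge: if
`|Ae| ≥ 4 (r - k)` there are `numParts |Ae|` parts, of size at most `5`; otherwise `Ae` is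
kept as a single part (there is no part if `Ae = ∅`). -/
def IsAdmissiblePartition (r k : ℕ) (Ae : Finset V) (P : Finpartition Ae) : Prop :=
  if 4 * (r - k) ≤ Ae.card then
    P.parts.card = numParts Ae.card ∧ ∀ p ∈ P.parts, p.card ≤ 5
  else
    ∀ p ∈ P.parts, p = Ae

/-- The hypergraph `H'` on the set `A` of active vertices induced by the partitions `P e` of the
sets `Ae = A ∩ e`: its edges are all the parts. -/
def partHypergraph (H : Hypergraph V) (A : Finset V)
    (P : (e : Finset V) → Finpartition (A ∩ e)) : Hypergraph V where
  vertexSet := ↑A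
  edgeSet := {p | ∃ e ∈ edges H, ∃ q ∈ (P e).parts, p = ↑q}
  subset_vertexSet_of_mem_edgeSet' := by
    rintro p ⟨e, -, q, hq, rfl⟩ x hx
    exact (Finset.mem_inter.1 ((P e).le hq hx)).1

/-- Processing one colour class `Vc` when the current set is `S`: every `v ∈ Vc` such that
`|Vc ∩ e| ≤ k - sat(e)` for all edges `e` containing `v` joins the set. -/
def colorStep (H : Hypergraph V) (k : ℕ) (Vc S : Finset V) : Finset V :=
  S ∪ Vc.filter fun v => ∀ e ∈ incidentEdges H v, (Vc ∩ e).card + sat S e ≤ k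

/-- The set obtained from `S` by processing the first `j` colour classes, in increasing order, of
the colouring `f` of the vertices in `A`. -/
def afterColors (H : Hypergraph V) (k : ℕ) (A : Finset V) {m : ℕ} (f : V → Fin m)
    (S : Finset V) : ℕ → Finset V
  | 0 => S
  | j + 1 => colorStep H k (A.filter fun v => (f v : ℕ) = j) (afterColors H k A f S j)

/-- One iteration of the main loop, from the pair `s = (S, A)` (current set, active vertices) to
the pair `s'`. Any admissible partitions of the sets `A ∩ e` and any proper colouring of the
resulting hypergraph with `4 Δ (r - k) + 1` colours may be used. -/
def Iteration (H : Hypergraph V) (Δ r k : ℕ) (s s' : Finset V × Finset V) : Prop :=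
  ∃ (P : (e : Finset V) → Finpartition (s.2 ∩ e)) (f : V → Fin (4 * Δ * (r - k) + 1)),
    (∀ e ∈ edges H, IsAdmissiblePartition r k (s.2 ∩ e) (P e)) ∧
    IsProperColoring (partHypergraph H s.2 P) f ∧
    s'.1 = afterColors H k s.2 f s.1 (4 * Δ * (r - k) + 1) ∧
    s'.2 = (s.2 \ s'.1).filter fun v => ∀ e ∈ incidentEdges H v, sat s'.1 e ≠ k

/-- The number of iterations `i = 1, 2, …, 1 + Δ log₂ r` of the main loop. -/
def numIterations (Δ r : ℕ) : ℕ := 1 + ⌊(Δ : ℝ) * Real.logb 2 r⌋₊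

/-- `S` is the output of an execution of the algorithm kWeakMIS on `H`: starting with the empty
set and all vertices active, run the main loop. -/
def IsOutputOfKWeakMIS (H : Hypergraph V) (Δ r k : ℕ) (S : Finset V) : Prop :=
  ∃ s : ℕ → Finset V × Finset V,
    s 0 = (∅, Finset.univ) ∧
    (∀ i < numIterations Δ r, Iteration H Δ r k (s i) (s (i + 1))) ∧
    S = (s (numIterations Δ r)).1

end Hypergraphs

/-! ## The LOCAL model -/

/-- The parameters known to all vertices. -/
structure Params where
  /-- number of vertices -/
  n : ℕ
  /-- bound on the maximum degree -/
  Δ : ℕ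
  /-- rank -/
  r : ℕ
  /-- weakness of the independent set -/
  k : ℕ

/-- A deterministic synchronous message-passing algorithm in the LOCAL model, with outputs in
`Out`. Local computations and the size of states and messages are unrestricted. -/
structure LocalAlgorithm (Out : Type) where
  /-- local states -/
  State : Type
  /-- messages -/
  Msg : Type
  /-- initial state, computed from the parameters, the own identifier and the incident edges
  (each given as the set of identifiers of its vertices) -/
  init : Params → ℕ → Finset (Finset ℕ) → State
  /-- message that a vertex in a given state sends to the neighbour with a given identifier -/
  send : State → ℕ → Msg
  /-- new state, computed from the old state and the set of received messages, each tagged with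
  the identifier of its sender -/
  recv : State → Set (ℕ × Msg) → State
  /-- output, computed from the final state -/
  output : State → Out
  /-- number of communication rounds -/
  rounds : Params → ℕ

namespace LocalAlgorithm

variable {Out : Type} {V : Type u} [Fintype V] [DecidableEq V]

/-- The state of each vertex after a given number of rounds, when the algorithm is run on the
hypergraph `H` with identifiers `ident`. -/
def state (A : LocalAlgorithm Out) (p : Params) (H : Hypergraph V) (ident : V → ℕ) :
    ℕ → V → A.State
  | 0, v => A.init p (ident v) ((incidentEdges H v).image fun e => e.image ident)
  | t + 1, v => A.recv (A.state p H ident t v)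
      {x | ∃ u, u ≠ v ∧ H.Adj u v ∧ x = (ident u, A.send (A.state p H ident t u) (ident v))}

/-- The output of each vertex at the end of the run. -/
def result (A : LocalAlgorithm Out) (p : Params) (H : Hypergraph V) (ident : V → ℕ) (v : V) :
    Out :=
  A.output (A.state p H ident (A.rounds p) v)

end LocalAlgorithm

/-- The set of vertices that output `true`. -/
def selectedSet {V : Type u} [Fintype V] [DecidableEq V] (A : LocalAlgorithm Bool) (p : Params)
    (H : Hypergraph V) (ident : V → ℕ) : Finset V :=
  Finset.univ.filter fun v => A.result p H ident v = true

end

end WeakMIS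

namespace WeakMIS

universe u

noncomputable section

open scoped Classical

/-! ## Correctness of kWeakMIS -/

section Correctness

/-! Correctness rests on a potential argument. If `v` is still active after an iteration, then when
its colour was processed some edge `e` containing `v` had too many vertices of that colour. A proper
colouring repeats a colour on `e` at most once per part. A single part would therefore force `e` to
be saturated, which would deactivate `v`. So `e` had about `|A ∩ e| / 4` parts, with `|A ∩ e| ≥ 4 (r
- k)`, and the failed test says that `sat e` was already within that many of `k`. Since saturation
plus active vertices never exceeds `r`, at most half of `A ∩ e` survives
(`exists_incidentEdge_halved`). Hence the sum of `log |A ∩ e|` over the edges at `v` starts at most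
at `Δ log r`, drops by at least 1 per iteration and stays nonnegative while `v` is active. After `1
+ ⌊Δ log r⌋` iterations no vertex is active, and every vertex outside `S` then lies in a saturated
edge, which is maximality.

For the running time, one colouring of the graph of pairs sharing an edge is computed from the
identifiers by Linial's method, with `O((Δ r)³)` colours and in `log* n + O(1)` rounds. Every
iteration restarts from it. The part graph has degree at most `D = 4 Δ (r - k)`; Linial's reduction,
one more polynomial step, the additive group algorithm and the removal of single colours turn the
saved colouring into one with `D + 1` colours in `O(D) + log* r + Δ + O(1)` rounds
(`exists_coloring_program`). Processing the colour classes costs `D + 1` more rounds. All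
recolouring rules depend only on the parameters, so they form a fixed program, and
`foldl_iterationRounds` shows that running it performs a legal iteration. -/

lemma mem_edges {V : Type u} [Fintype V] {H : Hypergraph V} {e : Finset V} :
    e ∈ edges H ↔ (e : Set V) ∈ H.edgeSet := by
  simp [edges]

lemma sat_mono {V : Type u} [DecidableEq V] {S T : Finset V} (h : S ⊆ T) (e : Finset V) :
    sat S e ≤ sat T e :=
  Finset.card_le_card (Finset.inter_subset_inter_left h)

variable {V : Type u} [Fintype V] [DecidableEq V] {H : Hypergraph V} {Δ r k : ℕ}

lemma mem_incidentEdges {v : V} {e : Finset V} :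
    e ∈ incidentEdges H v ↔ e ∈ edges H ∧ v ∈ e := by
  simp [incidentEdges]

lemma subset_colorStep (Vc S : Finset V) : S ⊆ colorStep H k Vc S :=
  Finset.subset_union_left

/-- Simultaneous joining is harmless: the test passed by one joining vertex of `e` already counts
every vertex of `Vc ∩ e`, so it bounds the new saturation whichever of them join. -/
lemma IsKWeakIS.colorStep {S : Finset V} (hS : IsKWeakIS H k S) (Vc : Finset V) :
    IsKWeakIS H k (colorStep H k Vc S) := by
  intro e he
  by_cases h : ∃ v ∈ e, v ∈ Vc.filter fun v => ∀ e ∈ incidentEdges H v, (Vc ∩ e).card + sat S e ≤ k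
  · obtain ⟨v, hve, hv⟩ := h
    have hv' := (Finset.mem_filter.1 hv).2 e (mem_incidentEdges.2 ⟨he, hve⟩)
    refine le_trans ?_ hv'
    rw [WeakMIS.colorStep, Finset.inter_union_distrib_left]
    refine (Finset.card_union_le _ _).trans ?_
    rw [add_comm, sat]
    refine Nat.add_le_add_right (Finset.card_le_card fun x hx => ?_) _
    simp only [Finset.mem_inter, Finset.mem_filter] at hx ⊢
    exact ⟨hx.2.1, hx.1⟩
  · push Not at h
    have : e ∩ WeakMIS.colorStep H k Vc S = e ∩ S := by
      ext x
      simp only [WeakMIS.colorStep, Finset.mem_inter, Finset.mem_union]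
      constructor
      · rintro ⟨h1, h2 | h2⟩
        · exact ⟨h1, h2⟩
        · exact absurd h2 (h x h1)
      · rintro ⟨h1, h2⟩
        exact ⟨h1, Or.inl h2⟩
    rw [this]
    exact hS e he

lemma IsKWeakIS.afterColors {S : Finset V} (hS : IsKWeakIS H k S) (A : Finset V) {m : ℕ}
    (f : V → Fin m) (j : ℕ) : IsKWeakIS H k (afterColors H k A f S j) := by
  induction j with
  | zero => exact hS
  | succ j ih => exact ih.colorStep _

lemma afterColors_mono (A : Finset V) {m : ℕ} (f : V → Fin m) (S : Finset V) :
    Monotone (afterColors H k A f S) :=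
  monotone_nat_of_le_succ fun _ => subset_colorStep _ _

lemma afterColors_subset (A : Finset V) {m : ℕ} (f : V → Fin m) (S : Finset V) (j : ℕ) :
    afterColors H k A f S j ⊆ S ∪ A := by
  induction j with
  | zero => exact Finset.subset_union_left
  | succ j ih =>
    refine Finset.union_subset ih fun x hx => ?_
    simp only [Finset.mem_filter] at hx
    exact Finset.mem_union_right _ hx.1.1

/-- A proper colouring uses each colour at most once in each part. -/
lemma card_colorClass_inter_le {A : Finset V} {P : (e : Finset V) → Finpartition (A ∩ e)} {m : ℕ}
    {f : V → Fin m} (hf : IsProperColoring (partHypergraph H A P) f) {e : Finset V}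
    (he : e ∈ edges H) (j : ℕ) :
    ((A.filter fun v => (f v : ℕ) = j) ∩ e).card ≤ (P e).parts.card := by
  have hmem : ∀ u ∈ (A.filter fun v => (f v : ℕ) = j) ∩ e, u ∈ A ∩ e ∧ (f u : ℕ) = j := by
    intro u hu
    simp only [Finset.mem_inter, Finset.mem_filter] at hu ⊢
    tauto
  refine Finset.card_le_card_of_injOn (fun u => (P e).part u)
    (fun u hu => (P e).part_mem.2 (hmem u hu).1) fun u hu w hw huw => ?_
  by_contra hne
  obtain ⟨hu, hu'⟩ := hmem u hu
  obtain ⟨hw, hw'⟩ := hmem w hw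
  refine hf u w hne ⟨((P e).part u : Finset V), ⟨e, he, _, (P e).part_mem.2 hu, rfl⟩,
    (P e).mem_part hu, ?_⟩ (Fin.ext (hu'.trans hw'.symm))
  have huw : (P e).part u = (P e).part w := huw
  rw [huw]
  exact (P e).mem_part hw

/-- The loop invariant of kWeakMIS. -/
structure LoopInvariant (H : Hypergraph V) (k : ℕ) (s : Finset V × Finset V) : Prop where
  indep : IsKWeakIS H k s.1
  disj : Disjoint s.1 s.2
  saturated : ∀ v, v ∉ s.1 → v ∉ s.2 → ∃ e ∈ incidentEdges H v, sat s.1 e = k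

lemma LoopInvariant.init (H : Hypergraph V) (k : ℕ) : LoopInvariant H k (∅, Finset.univ) where
  indep := fun e _ => by simp
  disj := Finset.disjoint_empty_left _
  saturated := fun v _ h => absurd (Finset.mem_univ v) h

lemma LoopInvariant.iteration {s s' : Finset V × Finset V} (h : LoopInvariant H k s)
    (hs : Iteration H Δ r k s s') : LoopInvariant H k s' := by
  obtain ⟨P, f, -, -, h1, h2⟩ := hs
  have hsub : s.1 ⊆ s'.1 := by
    rw [h1]
    exact afterColors_mono _ _ _ (Nat.zero_le _)
  have hind : IsKWeakIS H k s'.1 := by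
    rw [h1]
    exact h.indep.afterColors _ _ _
  refine ⟨hind, ?_, fun v hv hv' => ?_⟩
  · rw [h2]
    exact (Finset.sdiff_disjoint.mono_left (Finset.filter_subset _ _)).symm
  · by_cases hvA : v ∈ s.2
    · by_contra! hcon
      exact hv' (h2 ▸ Finset.mem_filter.2 ⟨Finset.mem_sdiff.2 ⟨hvA, hv⟩, hcon⟩)
    · obtain ⟨e, he, hek⟩ := h.saturated v (fun hh => hv (hsub hh)) hvA
      exact ⟨e, he, le_antisymm (hind e (mem_incidentEdges.1 he).1)
        (hek ▸ sat_mono hsub e)⟩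

/-- A vertex that remains active has an incident edge that lost half of its active vertices. -/
lemma exists_incidentEdge_halved {s s' : Finset V × Finset V} (hr : IsUniform H r) (hk : k < r)
    (h : LoopInvariant H k s) (hs : Iteration H Δ r k s s') {v : V} (hv : v ∈ s'.2) :
    ∃ e ∈ incidentEdges H v, 2 * (s'.2 ∩ e).card ≤ (s.2 ∩ e).card := by
  obtain ⟨P, f, hP, hf, h1, h2⟩ := hs
  rw [h2, Finset.mem_filter, Finset.mem_sdiff] at hv
  obtain ⟨⟨hvA, hvS⟩, hunsat⟩ := hv
  have hj : (f v : ℕ) + 1 ≤ 4 * Δ * (r - k) + 1 := (f v).2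
  have hnot : v ∉ afterColors H k s.2 f s.1 ((f v : ℕ) + 1) := fun hh =>
    hvS (h1 ▸ afterColors_mono _ _ _ hj hh)
  set T := afterColors H k s.2 f s.1 (f v : ℕ) with hT
  have hnot' : ¬ ∀ e ∈ incidentEdges H v,
      ((s.2.filter fun w => (f w : ℕ) = (f v : ℕ)) ∩ e).card + sat T e ≤ k := fun hh =>
    hnot (Finset.mem_union_right _ (Finset.mem_filter.2
      ⟨Finset.mem_filter.2 ⟨hvA, rfl⟩, hh⟩))
  push Not at hnot'
  obtain ⟨e, he, hek⟩ := hnot'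
  have heE := (mem_incidentEdges.1 he).1
  have hTs : sat T e ≤ sat s'.1 e :=
    sat_mono (h1 ▸ afterColors_mono _ _ _ ((Nat.le_succ _).trans hj)) e
  have hcard := card_colorClass_inter_le hf heE (f v : ℕ)
  have hlt : sat s'.1 e < k := by
    refine lt_of_le_of_ne ?_ (hunsat e he)
    rw [h1]
    exact h.indep.afterColors _ _ _ e heE
  have hadm := hP e heE
  refine ⟨e, he, ?_⟩
  unfold IsAdmissiblePartition at hadm
  split_ifs at hadm with hbig
  -- With `a`, `a'` the old and new numbers of active vertices in `e` and `p` the number of parts,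
  -- the failed test gives `sat ≥ k + 1 - p`, hence `a' ≤ r - k - 1 + p`. As `r - k ≤ ⌊a / 4⌋` and
  -- `p ≤ ⌊a / 4⌋ + 1`, this is at most `2 ⌊a / 4⌋ ≤ a / 2`.
  · have hsum : sat s.1 e + (s.2 ∩ e).card ≤ r := by
      rw [← hr e heE, sat, Finset.inter_comm s.2 e, ← Finset.card_union_of_disjoint]
      · exact Finset.card_le_card (Finset.union_subset Finset.inter_subset_left
          Finset.inter_subset_left)
      · exact h.disj.mono Finset.inter_subset_right Finset.inter_subset_right
    have hsum' : sat s'.1 e + (s'.2 ∩ e).card ≤ sat s.1 e + (s.2 ∩ e).card := by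
      have hd : Disjoint s'.1 s'.2 := by
        rw [h2]
        exact (Finset.sdiff_disjoint.mono_left (Finset.filter_subset _ _)).symm
      have hsub : s'.1 ∪ s'.2 ⊆ s.1 ∪ s.2 := by
        refine Finset.union_subset (h1 ▸ afterColors_subset _ _ _ _) ?_
        rw [h2]
        exact ((Finset.filter_subset _ _).trans Finset.sdiff_subset).trans
          Finset.subset_union_right
      rw [sat, sat, Finset.inter_comm s.2 e, Finset.inter_comm s'.2 e,
        ← Finset.card_union_of_disjoint, ← Finset.card_union_of_disjoint,
        ← Finset.inter_union_distrib_left, ← Finset.inter_union_distrib_left]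
      · exact Finset.card_le_card (Finset.inter_subset_inter_left hsub)
      · exact h.disj.mono Finset.inter_subset_right Finset.inter_subset_right
      · exact hd.mono Finset.inter_subset_right Finset.inter_subset_right
    rw [hadm.1] at hcard
    unfold numParts at hcard
    split_ifs at hcard <;> omega
  -- With at most one part, the failed test forces `sat T e ≥ k`, contradicting `hlt`.
  · have : (P e).parts.card ≤ 1 :=
      Finset.card_le_one.2 fun p hp q hq => (hadm p hp).trans (hadm q hq).symm
    omega

theorem IsOutputOfKWeakMIS.isKWeakMIS {S : Finset V} (hr : IsUniform H r)
    (hΔ : MaxDegreeLE H Δ) (hk : k < r) (hS : IsOutputOfKWeakMIS H Δ r k S) :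
    IsKWeakMIS H k S := by
  obtain ⟨s, hs0, hs, rfl⟩ := hS
  set N := numIterations Δ r with hN
  have hinv : ∀ i ≤ N, LoopInvariant H k (s i) := by
    intro i
    induction i with
    | zero => exact fun _ => hs0 ▸ LoopInvariant.init H k
    | succ i ih => exact fun hi => (ih (by omega)).iteration (hs i hi)
  have hlog : 0 ≤ Real.logb 2 r :=
    Real.logb_nonneg (by norm_num) (by exact_mod_cast (by omega : 1 ≤ r))
  -- Potential of an active vertex: every iteration it survives costs one unit. All logarithms are
  -- of positive integers because `v` itself lies in `A ∩ e`.
  have hpot : ∀ i ≤ N, ∀ v ∈ (s i).2,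
      ∑ e ∈ incidentEdges H v, Real.logb 2 ((s i).2 ∩ e).card + i ≤ Δ * Real.logb 2 r := by
    intro i
    induction i with
    | zero =>
      intro _ v _
      rw [hs0]
      have : ∀ e ∈ incidentEdges H v,
          Real.logb 2 ((Finset.univ ∩ e).card : ℝ) = Real.logb 2 r := fun e he => by
        rw [Finset.univ_inter, hr e (mem_incidentEdges.1 he).1]
      rw [Finset.sum_congr rfl this, Finset.sum_const, nsmul_eq_mul, Nat.cast_zero, add_zero]
      exact mul_le_mul_of_nonneg_right (by exact_mod_cast hΔ v) hlog
    | succ i ih =>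
      intro hi v hv
      have hit := hs i hi
      have hsub : (s (i + 1)).2 ⊆ (s i).2 := by
        obtain ⟨P, f, -, -, -, h2⟩ := hit
        rw [h2]
        exact (Finset.filter_subset _ _).trans Finset.sdiff_subset
      refine le_trans ?_ (ih (by omega) v (hsub hv))
      obtain ⟨e, he, hhalf⟩ := exists_incidentEdge_halved hr hk (hinv i (by omega)) hit hv
      have hpos : ∀ e ∈ incidentEdges H v, 0 < ((s (i + 1)).2 ∩ e).card := fun e he =>
        Finset.card_pos.2 ⟨v, Finset.mem_inter.2 ⟨hv, (mem_incidentEdges.1 he).2⟩⟩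
      rw [← Finset.add_sum_erase _ _ he, ← Finset.add_sum_erase _ _ he]
      have h1 : Real.logb 2 ((s (i + 1)).2 ∩ e).card + 1 ≤ Real.logb 2 ((s i).2 ∩ e).card := by
        have h0 : (0 : ℝ) < ((s (i + 1)).2 ∩ e).card := by exact_mod_cast hpos e he
        have : Real.logb 2 (((s (i + 1)).2 ∩ e).card * 2 : ℝ) =
            Real.logb 2 ((s (i + 1)).2 ∩ e).card + 1 := by
          rw [Real.logb_mul h0.ne' (by norm_num), Real.logb_self_eq_one (by norm_num)]
        rw [← this]
        exact Real.logb_le_logb_of_le (by norm_num) (by positivity)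
          (by rw [mul_comm]; exact_mod_cast hhalf)
      have h2 : ∑ e ∈ (incidentEdges H v).erase e, Real.logb 2 ((s (i + 1)).2 ∩ e).card ≤
          ∑ e ∈ (incidentEdges H v).erase e, Real.logb 2 ((s i).2 ∩ e).card := by
        refine Finset.sum_le_sum fun e' he' => ?_
        have := hpos e' (Finset.mem_of_mem_erase he')
        exact Real.logb_le_logb_of_le (by norm_num) (by exact_mod_cast this)
          (by exact_mod_cast Finset.card_le_card (Finset.inter_subset_inter_right hsub))
      push_cast
      linarith
  have hempty : ∀ v, v ∉ (s N).2 := by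
    intro v hv
    have h1 := hpot N le_rfl v hv
    have h2 : 0 ≤ ∑ e ∈ incidentEdges H v, Real.logb 2 ((s N).2 ∩ e).card := by
      refine Finset.sum_nonneg fun e he => Real.logb_nonneg (by norm_num) ?_
      have : 0 < ((s N).2 ∩ e).card :=
        Finset.card_pos.2 ⟨v, Finset.mem_inter.2 ⟨hv, (mem_incidentEdges.1 he).2⟩⟩
      exact_mod_cast this
    have h3 : (N : ℝ) = 1 + (⌊(Δ : ℝ) * Real.logb 2 r⌋₊ : ℝ) := by
      rw [hN, numIterations]
      push_cast
      rfl
    have := Nat.lt_floor_add_one ((Δ : ℝ) * Real.logb 2 r)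
    linarith
  refine ⟨(hinv N le_rfl).indep, fun T hT hST v hvT => ?_⟩
  by_contra hvS
  obtain ⟨e, he, hek⟩ := (hinv N le_rfl).saturated v hvS (hempty v)
  obtain ⟨heE, hve⟩ := mem_incidentEdges.1 he
  have hlt : (e ∩ (s N).1).card < (e ∩ T).card := by
    refine Finset.card_lt_card ⟨Finset.inter_subset_inter_left hST, fun hh => hvS ?_⟩
    exact (Finset.mem_inter.1 (hh (Finset.mem_inter.2 ⟨hve, hvT⟩))).2
  have := hT e heE
  rw [sat] at hek
  omega

end Correctness

/-! ## The iterated logarithm and the number of colour reduction steps -/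

section IteratedLogarithm

/-- One logarithm lowers the bound by at least 1, because `m + 2 ≤ 2 ^ (m + 1)`. This makes the set
defining `logStar` nonempty and also gives the crude bound `logStar m ≤ m`. -/
lemma exists_iterate_logb_le_one (m : ℕ) :
    ∀ x : ℝ, x ≤ m + 1 → ∃ i ≤ m, (Real.logb 2)^[i] x ≤ 1 := by
  induction m with
  | zero => exact fun x hx => ⟨0, le_rfl, by simpa using hx⟩
  | succ m ih =>
    intro x hx
    by_cases h1 : x ≤ 1
    · exact ⟨0, Nat.zero_le _, by simpa using h1⟩
    · push Not at h1
      have h2 : Real.logb 2 x ≤ m + 1 := by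
        rw [Real.logb_le_iff_le_rpow (by norm_num) (by linarith)]
        refine hx.trans ?_
        have : (m + 1) + 1 ≤ 2 ^ (m + 1) := Nat.lt_two_pow_self
        have h3 : ((m + 1 : ℕ) : ℝ) + 1 ≤ (2 : ℝ) ^ (m + 1) := by exact_mod_cast this
        refine h3.trans_eq ?_
        rw [← Real.rpow_natCast]
        push_cast
        rfl
      obtain ⟨i, hi, hi'⟩ := ih _ h2
      exact ⟨i + 1, by omega, by simpa [Function.iterate_succ_apply] using hi'⟩

lemma iterate_logStar_le_one (x : ℝ) : (Real.logb 2)^[logStar x] x ≤ 1 := by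
  refine Nat.sInf_mem (s := {i : ℕ | (Real.logb 2)^[i] x ≤ 1}) ?_
  obtain ⟨i, -, hi⟩ := exists_iterate_logb_le_one ⌈x⌉₊ x ((Nat.le_ceil x).trans (by linarith))
  exact ⟨i, hi⟩

lemma one_lt_iterate_of_lt_logStar {x : ℝ} {i : ℕ} (h : i < logStar x) :
    1 < (Real.logb 2)^[i] x := by
  by_contra! hcon
  exact absurd (Nat.sInf_le (s := {i : ℕ | (Real.logb 2)^[i] x ≤ 1}) hcon) (not_le.2 h)

lemma logStar_natCast_le (m : ℕ) : logStar (m : ℝ) ≤ m := by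
  obtain ⟨i, hi, hi'⟩ := exists_iterate_logb_le_one m (m : ℝ) (by linarith)
  exact (Nat.sInf_le (s := {i : ℕ | (Real.logb 2)^[i] (m : ℝ) ≤ 1}) hi').trans hi

/-- The map `x ↦ 4 ⌈log₂ x⌉ + 2`, which governs the decrease of the bit length of colours. -/
def logShrink (x : ℕ) : ℕ := 4 * Nat.clog 2 x + 2

/-- The number of applications of `logShrink` that bring `x` down to `24`. -/
def shrinkTime (x : ℕ) : ℕ := sInf {t : ℕ | logShrink^[t] x ≤ 24}

lemma logShrink_mono : Monotone logShrink := fun _ _ h => by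
  unfold logShrink
  have := Nat.clog_mono_right 2 h
  omega

/-- Some threshold is unavoidable, since 22 is a fixed point of `logShrink`. Up to 32 the value is
at most 22; beyond that exponential growth wins. -/
lemma logShrink_lt {x : ℕ} (hx : 24 < x) : logShrink x < x := by
  have key : ∀ j : ℕ, 4 * (j + 5) + 7 ≤ 2 ^ (j + 5) := by
    intro j
    induction j with
    | zero => norm_num
    | succ j ih => rw [show j + 1 + 5 = (j + 5) + 1 by ring, pow_succ]; omega
  unfold logShrink
  by_cases h : x ≤ 2 ^ 5
  · have := Nat.clog_le_of_le_pow h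
    omega
  · have h1 : 5 < Nat.clog 2 x := by
      by_contra! h2
      exact h ((Nat.le_pow_clog (by norm_num) x).trans (Nat.pow_le_pow_right (by norm_num) h2))
    obtain ⟨j, hj⟩ : ∃ j, Nat.clog 2 x = j + 5 + 1 := ⟨Nat.clog 2 x - 6, by omega⟩
    have h2 : 2 ^ (j + 5) < x := by
      by_contra! h3
      have := Nat.clog_le_of_le_pow h3
      omega
    have := key j
    omega

lemma exists_iterate_logShrink_le (A : ℕ) : ∀ x ≤ A + 24, ∃ t ≤ A, logShrink^[t] x ≤ 24 := by
  induction A with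
  | zero => exact fun x hx => ⟨0, le_rfl, by simpa using hx⟩
  | succ A ih =>
    intro x hx
    by_cases h : x ≤ 24
    · exact ⟨0, Nat.zero_le _, h⟩
    · have := logShrink_lt (not_le.1 h)
      obtain ⟨t, ht, ht'⟩ := ih (logShrink x) (by omega)
      exact ⟨t + 1, by omega, by simpa [Function.iterate_succ_apply] using ht'⟩

lemma iterate_shrinkTime_le (x : ℕ) : logShrink^[shrinkTime x] x ≤ 24 := by
  refine Nat.sInf_mem (s := {t : ℕ | logShrink^[t] x ≤ 24}) ?_
  obtain ⟨t, -, ht⟩ := exists_iterate_logShrink_le x x (by omega)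
  exact ⟨t, ht⟩

lemma shrinkTime_le_of_iterate_le {x t A : ℕ} (h : logShrink^[t] x ≤ A) :
    shrinkTime x ≤ A + t := by
  obtain ⟨t', h1, h2⟩ := exists_iterate_logShrink_le A _ (h.trans (Nat.le_add_right _ 24))
  rw [← Function.iterate_add_apply] at h2
  exact (Nat.sInf_le (s := {t : ℕ | logShrink^[t] x ≤ 24}) h2).trans (by omega)

lemma shrinkTime_mono : Monotone shrinkTime := fun x y h =>
  Nat.sInf_le (s := {t : ℕ | logShrink^[t] x ≤ 24})
    ((logShrink_mono.iterate _ h).trans (iterate_shrinkTime_le y))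

lemma natClog_le_logb_add_one {x : ℕ} (hx : 1 ≤ x) : (Nat.clog 2 x : ℝ) ≤ Real.logb 2 x + 1 := by
  have h := Real.natCeil_logb_natCast 2 x
  rw [← h]
  refine (Nat.ceil_lt_add_one (Real.logb_nonneg (by norm_num) (by exact_mod_cast hx))).le

/-- The slope `1 / 16` is chosen so that four times the logarithm of a constant costs only a quarter
of that constant plus 20. -/
lemma logb_two_le_div_add {y : ℝ} (hy : 0 < y) : Real.logb 2 y ≤ y / 16 + 5 := by
  have h1 : Real.logb 2 y = Real.logb 2 (y / 32) + 5 := by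
    have : Real.logb 2 (32 : ℝ) = 5 := by
      rw [show (32 : ℝ) = 2 ^ (5 : ℝ) by norm_num, Real.logb_rpow (by norm_num) (by norm_num)]
    rw [Real.logb_div hy.ne' (by norm_num), this]
    ring
  have h2 : Real.logb 2 (y / 32) ≤ y / 16 := by
    have hl : (0.5 : ℝ) < Real.log 2 := by linarith [Real.log_two_gt_d9]
    rw [Real.logb, div_le_iff₀ (by linarith)]
    have := Real.log_le_sub_one_of_pos (show 0 < y / 32 by positivity)
    nlinarith
  linarith

/-- Logarithms of bit lengths are reached within `log* + O(1)` steps. -/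
lemma exists_shrinkTime_le_logStar (c : ℕ) :
    ∃ C : ℕ, ∀ N : ℕ, shrinkTime (c * Nat.clog 2 N + c) ≤ logStar N + C := by
  -- The bound `A + B * l` must reproduce itself under `logShrink`. This needs `B ≥ 4` and `4 log (A
  -- + B) + 6 ≤ A`; here `(A + B) / 4 + 26 = c + 43 ≤ A`.
  set B : ℕ := 2 * c + 4 with hB
  set A : ℕ := 2 * c + 64 with hA
  refine ⟨A + B, fun N => ?_⟩
  set x := c * Nat.clog 2 N + c with hx
  obtain h0 | h0 := Nat.eq_zero_or_pos (logStar N)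
  · have h1 := iterate_logStar_le_one N
    rw [h0, Function.iterate_zero, id] at h1
    have h2 : Nat.clog 2 N = 0 := Nat.clog_of_right_le_one (by exact_mod_cast h1) 2
    have h3 : logShrink^[0] x ≤ A + B := by
      rw [Function.iterate_zero, id, hx, h2]
      omega
    have := shrinkTime_le_of_iterate_le h3
    omega
  · have hN : (1 : ℝ) < N := by simpa using one_lt_iterate_of_lt_logStar h0
    have key : ∀ t, t + 1 ≤ logStar N →
        ((logShrink^[t] x : ℕ) : ℝ) ≤ A + B * (Real.logb 2)^[t + 1] N := by
      intro t
      induction t with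
      | zero =>
        intro _
        have h1 := natClog_le_logb_add_one (x := N) (by exact_mod_cast hN.le)
        have h2 : 0 ≤ Real.logb 2 N := Real.logb_nonneg (by norm_num) hN.le
        have h3 : (0 : ℝ) ≤ c := Nat.cast_nonneg c
        simp only [Function.iterate_zero, id, zero_add, Function.iterate_one, hx, hA, hB]
        push_cast
        nlinarith
      | succ t ih =>
        intro ht
        have h1 := ih (by omega)
        have h2 := one_lt_iterate_of_lt_logStar (show t + 1 < logStar (N : ℝ) by omega)
        rw [Function.iterate_succ_apply', Function.iterate_succ_apply']
        set l := (Real.logb 2)^[t + 1] N with hl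
        set y := logShrink^[t] x with hy
        have h3 : 0 ≤ Real.logb 2 l := Real.logb_nonneg (by norm_num) h2.le
        have hAr : (A : ℝ) = 2 * c + 64 := by rw [hA]; push_cast; ring
        have hBr : (B : ℝ) = 2 * c + 4 := by rw [hB]; push_cast; ring
        have hc0 : (0 : ℝ) ≤ c := Nat.cast_nonneg c
        obtain hy0 | hy0 := Nat.eq_zero_or_pos y
        · rw [hy0]
          have : logShrink 0 = 2 := by simp [logShrink]
          rw [this]
          push_cast
          nlinarith
        · have h4 := natClog_le_logb_add_one hy0
          have h5 : Real.logb 2 y ≤ Real.logb 2 (A + B : ℝ) + Real.logb 2 l := by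
            rw [← Real.logb_mul (by positivity) (by linarith)]
            refine Real.logb_le_logb_of_le (by norm_num) (by exact_mod_cast hy0) (h1.trans ?_)
            nlinarith
          have h6 := logb_two_le_div_add (show (0 : ℝ) < A + B by positivity)
          have h7 : ((logShrink y : ℕ) : ℝ) = 4 * Nat.clog 2 y + 2 := by
            unfold logShrink
            push_cast
            ring
          rw [h7]
          nlinarith
    have h1 := key (logStar N - 1) (by omega)
    rw [Nat.sub_add_cancel h0] at h1
    have h2 := iterate_logStar_le_one N
    have h3 : ((logShrink^[logStar N - 1] x : ℕ) : ℝ) ≤ (A + B : ℕ) := by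
      push_cast
      have : (0 : ℝ) ≤ B := Nat.cast_nonneg _
      nlinarith
    -- What is left is bounded by the constant `A + B`, which takes at most that many further steps.
    have := shrinkTime_le_of_iterate_le (Nat.cast_le.1 h3)
    omega

end IteratedLogarithm

/-! ## Distributed colouring of graphs of bounded degree -/

section Coloring

/-- A rule for one synchronous recolouring round: the new colour of a vertex is computed from its
old colour and the set of old colours of its neighbours. -/
abbrev ColorRule : Type := ℕ → Set ℕ → ℕ

/-- All vertices apply the rule `F` simultaneously. -/
def recolor {V : Type u} (G : SimpleGraph V) (F : ColorRule) (col : V → ℕ) : V → ℕ :=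
  fun v => F (col v) (col '' G.neighborSet v)

/-- All vertices apply the rules of a list one after the other. -/
def runColors {V : Type u} (G : SimpleGraph V) (L : List ColorRule) (col : V → ℕ) : V → ℕ :=
  L.foldl (fun col F => recolor G F col) col

/-- The colouring `col` of `G` is proper and uses only colours smaller than `M`. -/
def IsColoringLT {V : Type u} (G : SimpleGraph V) (M : ℕ) (col : V → ℕ) : Prop :=
  (∀ u v, G.Adj u v → col u ≠ col v) ∧ ∀ v, col v < M

/-- On every finite graph of maximum degree at most `D`, the rules in `L` turn proper colourings
with `M` colours into proper colourings with `M'` colours. -/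
def Reduces (D M M' : ℕ) (L : List ColorRule) : Prop :=
  ∀ (V : Type u) [Finite V] (G : SimpleGraph V) (col : V → ℕ),
    (∀ v, (G.neighborSet v).ncard ≤ D) → IsColoringLT G M col →
      IsColoringLT G M' (runColors G L col)

lemma IsColoringLT.mono {V : Type u} {G : SimpleGraph V} {M M' : ℕ} (h : M ≤ M') {col : V → ℕ}
    (hc : IsColoringLT G M col) : IsColoringLT G M' col :=
  ⟨hc.1, fun v => (hc.2 v).trans_le h⟩

lemma Reduces.mono {D M₁ M₂ M₁' M₂' : ℕ} {L : List ColorRule} (h : Reduces.{u} D M₁ M₁' L)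
    (h₁ : M₂ ≤ M₁) (h₂ : M₁' ≤ M₂') : Reduces.{u} D M₂ M₂' L :=
  fun V _ G col hd hc => (h V G col hd (hc.mono h₁)).mono h₂

lemma Reduces.nil (D M : ℕ) : Reduces.{u} D M M [] := fun _ _ _ _ _ hc => hc

lemma Reduces.append {D M₁ M₂ M₃ : ℕ} {L L' : List ColorRule} (h : Reduces.{u} D M₁ M₂ L)
    (h' : Reduces.{u} D M₂ M₃ L') : Reduces.{u} D M₁ M₃ (L ++ L') := by
  intro V _ G col hd hc
  rw [runColors, List.foldl_append]
  exact h' V G _ hd (h V G col hd hc)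

lemma runColors_replicate {V : Type u} (G : SimpleGraph V) (F : ColorRule) (t : ℕ)
    (col : V → ℕ) : runColors G (List.replicate t F) col = (recolor G F)^[t] col := by
  induction t generalizing col with
  | zero => rfl
  | succ t ih => exact ih _

/-! ### Linial's colour reduction -/

lemma exists_injOn_polynomials (q l : ℕ) [Fact q.Prime] :
    ∃ p : ℕ → Polynomial (ZMod q), (∀ m, p m ∈ Polynomial.degreeLT (ZMod q) l) ∧
      Set.InjOn p {m | m < q ^ l} := by
  have hcard : Fintype.card (Fin l → ZMod q) = q ^ l := by simp [ZMod.card]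
  let e := (Fintype.equivFinOfCardEq hcard).symm
  let d := (Polynomial.degreeLTEquiv (ZMod q) l).symm
  refine ⟨fun m => if h : m < q ^ l then (d (e ⟨m, h⟩) : Polynomial (ZMod q)) else 0,
    fun m => ?_, fun m hm m' hm' h => ?_⟩
  · dsimp only
    split_ifs with h
    · exact (d (e ⟨m, h⟩)).2
    · exact Submodule.zero_mem _
  · simp only [Set.mem_ofPred_eq] at hm hm'
    simp only [hm, hm', dif_pos] at h
    simpa using e.injective (d.injective (Subtype.ext h))

lemma card_eval_eq_le {q l : ℕ} [Fact q.Prime] {f g : Polynomial (ZMod q)}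
    (hf : f ∈ Polynomial.degreeLT (ZMod q) l) (hg : g ∈ Polynomial.degreeLT (ZMod q) l)
    (hfg : f ≠ g) : (Finset.univ.filter fun a : ZMod q => f.eval a = g.eval a).card ≤ l - 1 := by
  have h0 : f - g ≠ 0 := sub_ne_zero.2 hfg
  have hdeg := Polynomial.mem_degreeLT.1 (Submodule.sub_mem _ hf hg)
  have hnat : (f - g).natDegree < l := by
    rw [Polynomial.degree_eq_natDegree h0] at hdeg
    exact_mod_cast hdeg
  refine (Finset.card_le_card (t := (f - g).roots.toFinset) fun a ha => ?_).trans
    ((Multiset.toFinset_card_le _).trans ((Polynomial.card_roots' _).trans (by omega)))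
  rw [Finset.mem_filter] at ha
  rw [Multiset.mem_toFinset, Polynomial.mem_roots h0, Polynomial.IsRoot, Polynomial.eval_sub,
    ha.2, sub_self]

/-- Colours become distinct polynomials of degree less than `l` over the field with `q` elements.
Two of them agree in at most `l - 1` points, so `D` neighbours block fewer than `q` points. A vertex
picks an unblocked point `a` and takes the pair of `a` and its value there as new colour. Neighbours
with equal pairs would agree at an unblocked point. The default colour 0 is never used under the
hypotheses of `Reduces`. -/
lemma exists_linial_rule (D q l : ℕ) [Fact q.Prime] (hq : D * (l - 1) < q) :
    ∃ F : ColorRule, Reduces.{u} D (q ^ l) (q ^ 2) [F] := by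
  obtain ⟨p, hp, hinj⟩ := exists_injOn_polynomials q l
  refine ⟨fun c N => if h : ∃ a : ZMod q, ∀ c' ∈ N, (p c).eval a ≠ (p c').eval a then
    h.choose.val * q + ((p c).eval h.choose).val else 0, fun V _ G col hd hc => ?_⟩
  have hex : ∀ v, ∃ a : ZMod q, ∀ c' ∈ col '' G.neighborSet v,
      (p (col v)).eval a ≠ (p c').eval a := by
    intro v
    have hfin : (col '' G.neighborSet v).Finite := Set.toFinite _
    set N := hfin.toFinset with hN
    have hNcard : N.card ≤ D := by
      rw [hN, ← Set.ncard_eq_toFinset_card _ hfin]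
      exact (Set.ncard_image_le (Set.toFinite _)).trans (hd v)
    have hbad : (N.biUnion fun c' =>
        Finset.univ.filter fun a : ZMod q => (p (col v)).eval a = (p c').eval a).card < q := by
      refine lt_of_le_of_lt (Finset.card_biUnion_le_card_mul _ _ (l - 1) fun c' hc' => ?_)
        ((Nat.mul_le_mul_right _ hNcard).trans_lt hq)
      obtain ⟨w, hw, rfl⟩ := hfin.mem_toFinset.1 hc'
      exact card_eval_eq_le (hp _) (hp _) fun h =>
        hc.1 v w hw (hinj (hc.2 v) (hc.2 w) h)
    obtain ⟨a, ha⟩ : ∃ a, a ∉ N.biUnion fun c' =>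
        Finset.univ.filter fun a : ZMod q => (p (col v)).eval a = (p c').eval a := by
      by_contra! hall
      have := Finset.eq_univ_of_forall hall
      rw [this, Finset.card_univ, ZMod.card] at hbad
      exact lt_irrefl _ hbad
    refine ⟨a, fun c' hc' heq => ha ?_⟩
    simp only [Finset.mem_biUnion, Finset.mem_filter, Finset.mem_univ, true_and]
    exact ⟨c', hfin.mem_toFinset.2 hc', heq⟩
  have hrun : ∀ v, ∃ a : ZMod q,
      (∀ w, G.Adj v w → (p (col v)).eval a ≠ (p (col w)).eval a) ∧
      runColors G [fun c N => if h : ∃ a : ZMod q, ∀ c' ∈ N, (p c).eval a ≠ (p c').eval a then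
        h.choose.val * q + ((p c).eval h.choose).val else 0] col v =
        a.val * q + ((p (col v)).eval a).val := fun v =>
    ⟨(hex v).choose, fun w hw => (hex v).choose_spec _ ⟨w, hw, rfl⟩, dif_pos (hex v)⟩
  choose a ha hrun using hrun
  refine ⟨fun u v huv h => ?_, fun v => ?_⟩
  · rw [hrun, hrun] at h
    have hu := ZMod.val_lt ((p (col u)).eval (a u))
    have hv := ZMod.val_lt ((p (col v)).eval (a v))
    have hq0 : 0 < q := (Fact.out : q.Prime).pos
    have h1 : (a u).val = (a v).val := by
      have := congrArg (· / q) h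
      simpa [Nat.add_div_of_dvd_right, Nat.mul_div_cancel _ hq0, Nat.div_eq_of_lt hu,
        Nat.div_eq_of_lt hv, add_comm, Nat.add_mul_div_right _ _ hq0] using this
    have h2 : ((p (col u)).eval (a u)).val = ((p (col v)).eval (a v)).val := by
      rw [h1] at h
      exact Nat.add_left_cancel h
    have h3 : a u = a v := ZMod.val_injective q h1
    have h4 := ZMod.val_injective q h2
    rw [← h3] at h4
    exact ha u v huv h4
  · rw [hrun]
    have h1 := ZMod.val_lt ((p (col v)).eval (a v))
    have h2 := ZMod.val_lt (a v)
    nlinarith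

/-- Bertrand's postulate supplies a prime `q` between `x D` and `2 x D`. Polynomials with `x`
coefficients then suffice, because `2 ^ x ≤ q ^ x`. -/
lemma exists_linial_rule_two_pow {D x : ℕ} (hD : 1 ≤ D) (hx : 1 ≤ x) :
    ∃ F : ColorRule,
      Reduces.{u} D (2 ^ x) (2 ^ (2 * Nat.clog 2 D + 2 * Nat.clog 2 x + 2)) [F] := by
  obtain ⟨q, hq, hlt, hle⟩ := Nat.exists_prime_lt_and_le_two_mul (x * D) (by positivity)
  have : Fact q.Prime := ⟨hq⟩
  obtain ⟨F, hF⟩ := exists_linial_rule.{u} D q x (by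
    refine lt_of_le_of_lt ?_ hlt
    rw [mul_comm x D]
    exact Nat.mul_le_mul_left _ (Nat.sub_le _ _))
  refine ⟨F, hF.mono (Nat.pow_le_pow_left hq.two_le _) ?_⟩
  have h1 := Nat.le_pow_clog (b := 2) (by norm_num) D
  have h2 := Nat.le_pow_clog (b := 2) (by norm_num) x
  have h3 : q ≤ 2 ^ (Nat.clog 2 D + Nat.clog 2 x + 1) := by
    refine hle.trans ?_
    rw [pow_add, pow_add, pow_one, mul_comm _ 2, mul_comm x D]
    exact Nat.mul_le_mul_left _ (Nat.mul_le_mul h1 h2)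
  calc q ^ 2 ≤ (2 ^ (Nat.clog 2 D + Nat.clog 2 x + 1)) ^ 2 := Nat.pow_le_pow_left h3 _
    _ = _ := by rw [← pow_mul]; congr 1; ring

lemma exists_linial_iterate {D : ℕ} (hD : 1 ≤ D) (t : ℕ) : ∀ x, 1 ≤ x →
    ∃ L : List ColorRule, L.length = t ∧ Reduces.{u} D (2 ^ x)
      (2 ^ (fun x => 2 * Nat.clog 2 D + 2 * Nat.clog 2 x + 2)^[t] x) L := by
  induction t with
  | zero => exact fun x _ => ⟨[], rfl, Reduces.nil _ _⟩
  | succ t ih =>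
    intro x hx
    obtain ⟨F, hF⟩ := exists_linial_rule_two_pow.{u} hD hx
    obtain ⟨L, hL, hred⟩ := ih (2 * Nat.clog 2 D + 2 * Nat.clog 2 x + 2) (by omega)
    exact ⟨[F] ++ L, by simp [hL], hF.append hred⟩

lemma clog_four_mul_add_le (d : ℕ) : Nat.clog 2 (4 * d + 24) ≤ d + 5 := by
  refine Nat.clog_le_of_le_pow ?_
  induction d with
  | zero => norm_num
  | succ d ih => rw [show d + 1 + 5 = (d + 5) + 1 by ring, pow_succ]; omega

lemma clog_four_mul_add_le_half (d : ℕ) : Nat.clog 2 (4 * d + 24) ≤ d / 2 + 8 := by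
  refine Nat.clog_le_of_le_pow ?_
  have key : ∀ z : ℕ, 8 * z + 28 ≤ 2 ^ (z + 8) := by
    intro z
    induction z with
    | zero => norm_num
    | succ z ih => rw [show z + 1 + 8 = (z + 8) + 1 by ring, pow_succ]; omega
  have := key (d / 2)
  omega

/-- The bit length follows `logShrink` as long as its logarithm dominates `d`; otherwise one step
already lands below `4 d + 24`. -/
lemma iterate_linial_le (d x t : ℕ) :
    (fun x => 2 * d + 2 * Nat.clog 2 x + 2)^[t] x ≤ max (logShrink^[t] x) (4 * d + 24) := by
  induction t with
  | zero => exact le_max_left _ _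
  | succ t ih =>
    rw [Function.iterate_succ_apply', Function.iterate_succ_apply']
    have h1 := Nat.clog_mono_right 2 ih
    have h2 := clog_four_mul_add_le d
    rcases max_choice (logShrink^[t] x) (4 * d + 24) with h | h <;> rw [h] at h1
    · have : logShrink (logShrink^[t] x) = 4 * Nat.clog 2 (logShrink^[t] x) + 2 := rfl
      omega
    · omega

/-- Linial's algorithm: `2 ^ x` colours are reduced to `O(D³)` colours. -/
lemma exists_linial_program {D x : ℕ} (hD : 1 ≤ D) (hx : 1 ≤ x) :
    ∃ L : List ColorRule, L.length = shrinkTime x + 1 ∧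
      Reduces.{u} D (2 ^ x) (2 ^ (3 * Nat.clog 2 D + 18)) L := by
  obtain ⟨L, hL, hred⟩ := exists_linial_iterate.{u} hD (shrinkTime x + 1) x hx
  refine ⟨L, hL, hred.mono le_rfl (Nat.pow_le_pow_right (by norm_num) ?_)⟩
  -- The extra step improves the bit length from `4 d + 24` to `3 d + 18`, where `d = Nat.clog 2 D`.
  -- A cubic number of colours is what one polynomial step with three coefficients can absorb.
  rw [Function.iterate_succ_apply']
  have h1 := iterate_linial_le (Nat.clog 2 D) x (shrinkTime x)
  have h2 := iterate_shrinkTime_le x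
  rw [max_eq_right (by omega)] at h1
  have h3 := Nat.clog_mono_right 2 h1
  have h4 := clog_four_mul_add_le_half (Nat.clog 2 D)
  omega

/-! ### The additive group algorithm -/

/-- The recolouring rule of the additive group algorithm, for colours `a q + b` with `a, b < q`:
a vertex whose second coordinate `b` differs from those of all neighbours becomes `(0, b)`, any
other vertex moves to `(a, b + a)`. -/
def additiveRule (q : ℕ) : ColorRule := fun c N =>
  if ∃ c' ∈ N, c' % q = c % q then c / q * q + (c % q + c / q) % q else c % q

/-- Modulo `q` a colour is its second coordinate. It advances by `a` whenever `a` is kept; a vertex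
that finalises while keeping `a` has `a = 0`. -/
lemma additiveRule_cast {q : ℕ} [Fact q.Prime] {c : ℕ} {N : Set ℕ}
    (h : additiveRule q c N / q = c / q) :
    (additiveRule q c N : ZMod q) = c + (c / q : ℕ) := by
  have hq0 : 0 < q := (Fact.out : q.Prime).pos
  unfold additiveRule at h ⊢
  split_ifs at h ⊢ with hN
  · simp
  · rw [Nat.div_eq_of_lt (Nat.mod_lt _ hq0)] at h
    rw [← h]
    simp

lemma additiveRule_div {q : ℕ} [Fact q.Prime] (c : ℕ) (N : Set ℕ) :
    additiveRule q c N / q = c / q ∧ (∃ c' ∈ N, c' % q = c % q) ∨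
      additiveRule q c N / q = 0 := by
  have hq0 : 0 < q := (Fact.out : q.Prime).pos
  unfold additiveRule
  split_ifs with hN
  · left
    rw [add_comm, Nat.add_mul_div_right _ _ hq0, Nat.div_eq_of_lt (Nat.mod_lt _ hq0), zero_add]
    exact ⟨rfl, hN⟩
  · right
    exact Nat.div_eq_of_lt (Nat.mod_lt _ hq0)

lemma additiveRule_ne {q : ℕ} [Fact q.Prime] {c c' : ℕ} {N N' : Set ℕ}
    (hne : c ≠ c') (h : c' ∈ N) (h' : c ∈ N') :
    additiveRule q c N ≠ additiveRule q c' N' := by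
  have hq0 : 0 < q := (Fact.out : q.Prime).pos
  have hdm : ∀ a b : ℕ, (a * q + b % q) / q = a ∧ (a * q + b % q) % q = b % q := by
    intro a b
    constructor
    · rw [add_comm, Nat.add_mul_div_right _ _ hq0, Nat.div_eq_of_lt (Nat.mod_lt _ hq0), zero_add]
    · rw [Nat.add_mod, Nat.mul_mod_left, zero_add, Nat.mod_mod, Nat.mod_mod]
  have hbb : c / q = c' / q → c % q ≠ c' % q := fun h1 h2 =>
    hne (by rw [← Nat.div_add_mod c q, ← Nat.div_add_mod c' q, h1, h2])
  have hcast : ∀ a : ℕ, (c % q + a) % q = (c' % q + a) % q → c % q = c' % q := fun a h => by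
    have := Nat.ModEq.add_right_cancel' a (show c % q + a ≡ c' % q + a [MOD q] from h)
    simpa [Nat.ModEq] using this
  unfold additiveRule
  split_ifs with h1 h2 h2
  · intro heq
    have ha : c / q = c' / q := by
      rw [← (hdm (c / q) (c % q + c / q)).1, heq, (hdm _ _).1]
    have hb : (c % q + c / q) % q = (c' % q + c' / q) % q := by
      rw [← (hdm (c / q) (c % q + c / q)).2, heq, (hdm _ _).2]
    rw [← ha] at hb
    exact hbb ha (hcast _ hb)
  · intro heq
    have ha : c / q = 0 := by
      rw [← (hdm (c / q) (c % q + c / q)).1, heq, Nat.div_eq_of_lt (Nat.mod_lt _ hq0)]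
    rw [ha] at heq
    simp only [zero_mul, zero_add, add_zero, Nat.mod_mod] at heq
    exact h2 ⟨c, h', heq⟩
  · intro heq
    have ha : c' / q = 0 := by
      rw [← (hdm (c' / q) (c' % q + c' / q)).1, ← heq, Nat.div_eq_of_lt (Nat.mod_lt _ hq0)]
    rw [ha] at heq
    simp only [zero_mul, zero_add, add_zero, Nat.mod_mod] at heq
    exact h1 ⟨c', h, heq.symm⟩
  · intro heq
    exact h1 ⟨c', h, heq.symm⟩

lemma additiveRule_lt {q : ℕ} [Fact q.Prime] {c : ℕ} (N : Set ℕ) (hc : c < q ^ 2) :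
    additiveRule q c N < q ^ 2 := by
  have hq0 : 0 < q := (Fact.out : q.Prime).pos
  unfold additiveRule
  split_ifs
  · have h1 : c / q < q := Nat.div_lt_of_lt_mul (by rwa [← sq])
    have h2 := Nat.mod_lt (c % q + c / q) hq0
    nlinarith
  · have := Nat.mod_lt c hq0
    nlinarith

/-- A vertex that has not finalised after `q` rounds met a conflict in each of them. While first
coordinates stay fixed, second coordinates move linearly in time, so two neighbours with different
slopes collide at most once in `q` rounds. With equal slopes a collision would mean equal colours.
Each neighbour has one slope before and one after finalising, so it causes at most two conflicts,
and `2 D < q`. -/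
lemma reduces_additiveRule {D q : ℕ} [Fact q.Prime] (hq : D * 2 < q) :
    Reduces.{u} D (q ^ 2) q (List.replicate q (additiveRule q)) := by
  intro V _ G col hd hc
  have hq0 : 0 < q := (Fact.out : q.Prime).pos
  rw [runColors_replicate]
  set x : ℕ → V → ℕ := fun t => (recolor G (additiveRule q))^[t] col with hx
  have hxs : ∀ t v, x (t + 1) v = additiveRule q (x t v) (x t '' G.neighborSet v) := by
    intro t v
    simp only [hx, Function.iterate_succ_apply']
    rfl
  have hcol : ∀ t, IsColoringLT G (q ^ 2) (x t) := by
    intro t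
    induction t with
    | zero => exact hc
    | succ t ih =>
      refine ⟨fun u v huv => ?_, fun v => ?_⟩
      · rw [hxs, hxs]
        exact additiveRule_ne (ih.1 u v huv) ⟨v, huv, rfl⟩ ⟨u, huv.symm, rfl⟩
      · rw [hxs]
        exact additiveRule_lt _ (ih.2 v)
  have hdiv : ∀ v t, x (t + 1) v / q = x t v / q ∨ x (t + 1) v / q = 0 := by
    intro v t
    rw [hxs]
    exact (additiveRule_div _ _).imp_left And.left
  have hdiv' : ∀ v s t, s ≤ t → x t v / q = x s v / q ∨ x t v / q = 0 := by
    intro v s t hst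
    induction t, hst using Nat.le_induction with
    | base => exact Or.inl rfl
    | succ t _ ih =>
      rcases hdiv v t with h | h
      · rw [h]
        exact ih
      · exact Or.inr h
  have hcast : ∀ v s t, s ≤ t → x t v / q = x s v / q →
      (x t v : ZMod q) = x s v + (t - s : ℕ) * (x s v / q : ℕ) := by
    intro v s t hst
    induction t, hst using Nat.le_induction with
    | base => simp
    | succ t hst ih =>
      intro h
      have hcase : x t v / q = x s v / q ∧ x (t + 1) v / q = x t v / q := by
        rcases hdiv v t with h1 | h1
        · exact ⟨h1.symm.trans h, h1⟩
        · rcases hdiv' v s t hst with h2 | h2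
          · exact ⟨h2, h.trans h2.symm⟩
          · exact ⟨by rw [h2, ← h1, h], by rw [h2, h1]⟩
      have h3 : (x (t + 1) v : ZMod q) = x t v + (x t v / q : ℕ) := by
        have := hcase.2
        rw [hxs] at this ⊢
        exact additiveRule_cast this
      rw [h3, ih hcase.1, hcase.1, Nat.sub_add_comm hst]
      push_cast
      ring
  refine ⟨(hcol q).1, fun v => ?_⟩
  suffices h : x q v / q = 0 from Nat.lt_of_div_eq_zero hq0 h
  by_contra hne
  have hconst : ∀ t ≤ q, x t v / q = x q v / q := fun t ht =>
    ((hdiv' v t q ht).resolve_right hne).symm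
  have hconf : ∀ t : Fin q, ∃ w, G.Adj v w ∧ (x t w : ZMod q) = x t v := by
    intro t
    have h1 := hconst (t + 1) t.2
    rw [hxs] at h1
    rcases additiveRule_div (q := q) (x t v) (x t '' G.neighborSet v) with h2 | h2
    · obtain ⟨-, _, ⟨w, hw, rfl⟩, hw'⟩ := h2
      exact ⟨w, hw, (ZMod.natCast_eq_natCast_iff' _ _ _).2 hw'⟩
    · exact absurd (h1.symm.trans h2) hne
  choose w hw hw' using hconf
  let N := (Set.toFinite (G.neighborSet v)).toFinset
  have hN : N.card ≤ D := by
    rw [← Set.ncard_eq_toFinset_card]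
    exact hd v
  -- The Boolean records whether the conflicting neighbour already has first coordinate 0; within
  -- one such phase that coordinate is constant.
  have hpigeon : ((N ×ˢ (Finset.univ : Finset Bool)).card) < (Finset.univ : Finset (Fin q)).card := by
    rw [Finset.card_product, Finset.card_univ, Finset.card_univ, Fintype.card_bool,
      Fintype.card_fin]
    omega
  obtain ⟨s, -, t, -, hst, heq⟩ := Finset.exists_ne_map_eq_of_card_lt_of_maps_to hpigeon
    (f := fun t => (w t, decide (x t (w t) / q = 0))) (fun t _ => by
      simp only [Finset.coe_product, Set.mem_prod, Finset.mem_coe, Finset.mem_univ, and_true]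
      exact (Set.Finite.mem_toFinset _).2 (hw t))
  wlog hlt : s < t generalizing s t
  · exact this t s hst.symm heq.symm (lt_of_le_of_ne (not_lt.1 hlt) hst.symm)
  simp only [Prod.mk.injEq, decide_eq_decide] at heq
  obtain ⟨hwst, hz⟩ := heq
  have hs' := hw' s
  have ht' := hw' t
  rw [← hwst] at ht' hz
  set u := w s
  have hle : (s : ℕ) ≤ t := Fin.le_def.1 hlt.le
  have hu : x t u / q = x s u / q := by
    rcases hdiv' u s t hle with h | h
    · exact h
    · rw [h, hz.2 h]
  have h1 := hcast u s t hle hu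
  have h2 := hcast v s t hle ((hconst t t.2.le).trans (hconst s s.2.le).symm)
  rw [ht', h2, hs'] at h1
  have h3 := add_left_cancel h1
  have hnz : ((t - s : ℕ) : ZMod q) ≠ 0 := by
    rw [Ne, ZMod.natCast_eq_zero_iff]
    intro hdvd
    have h4 := Nat.le_of_dvd (Nat.sub_pos_of_lt (Fin.lt_def.1 hlt)) hdvd
    have := t.2
    omega
  have h4 := mul_left_cancel₀ hnz h3
  rw [ZMod.natCast_eq_natCast_iff'] at h4 hs'
  have h5 : ∀ y, x s y / q < q := fun y =>
    Nat.div_lt_of_lt_mul (by rw [← sq]; exact (hcol s).2 y)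
  rw [Nat.mod_eq_of_lt (h5 _), Nat.mod_eq_of_lt (h5 _)] at h4
  refine (hcol s).1 v u (hw s) ?_
  rw [← Nat.div_add_mod (x s v) q, ← Nat.div_add_mod (x s u) q, h4, hs']

/-! ### Removing one colour at a time -/

/-- The class of the top colour is independent, so its vertices can simultaneously take their least
free colours, which are at most `D`. -/
lemma exists_remove_color_rule {D M : ℕ} (hM : D < M) :
    ∃ F : ColorRule, Reduces.{u} D (M + 1) M [F] := by
  refine ⟨fun c N => if c = M then sInf Nᶜ else c, fun V _ G col hd hc => ?_⟩
  have hfree : ∀ v, sInf (col '' G.neighborSet v)ᶜ ≤ D ∧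
      sInf (col '' G.neighborSet v)ᶜ ∈ (col '' G.neighborSet v)ᶜ := by
    intro v
    obtain ⟨m, hm, hm'⟩ : ∃ m ≤ D, m ∈ (col '' G.neighborSet v)ᶜ := by
      by_contra! hcon
      have hsub : (↑(Finset.range (D + 1)) : Set ℕ) ⊆ col '' G.neighborSet v := by
        intro m hm
        by_contra hm'
        exact hcon m (by simpa [Nat.lt_succ_iff] using hm) hm'
      have h1 := Set.ncard_le_ncard hsub (Set.toFinite _)
      rw [Set.ncard_coe_finset, Finset.card_range] at h1
      have h2 := Set.ncard_image_le (f := col) (Set.toFinite (G.neighborSet v))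
      have := hd v
      omega
    exact ⟨(Nat.sInf_le hm').trans hm, Nat.sInf_mem ⟨m, hm'⟩⟩
  have hrun : ∀ v, runColors G [fun c N => if c = M then sInf Nᶜ else c] col v =
      if col v = M then sInf (col '' G.neighborSet v)ᶜ else col v := fun v => rfl
  refine ⟨fun u v huv => ?_, fun v => ?_⟩
  · have hne := hc.1 u v huv
    rw [hrun, hrun]
    split_ifs with h1 h2 h2
    · exact absurd (h1.trans h2.symm) hne
    · exact fun h => (hfree u).2 ⟨v, huv, h.symm⟩
    · exact fun h => (hfree v).2 ⟨u, huv.symm, h⟩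
    · exact hne
  · rw [hrun]
    split_ifs with h1
    · exact (hfree v).1.trans_lt hM
    · have := hc.2 v
      omega

lemma exists_remove_colors (D j : ℕ) :
    ∃ L : List ColorRule, L.length = j ∧ Reduces.{u} D (D + 1 + j) (D + 1) L := by
  induction j with
  | zero => exact ⟨[], rfl, Reduces.nil _ _⟩
  | succ j ih =>
    obtain ⟨L, hL, hred⟩ := ih
    obtain ⟨F, hF⟩ := exists_remove_color_rule.{u} (D := D) (M := D + 1 + j) (by omega)
    exact ⟨[F] ++ L, by simp [hL], hF.append hred⟩

/-- A proper colouring with `2 ^ x` colours is reduced to one with `D + 1` colours. -/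
lemma exists_coloring_program {D x : ℕ} (hD : 1 ≤ D) (hx : 1 ≤ x) :
    ∃ L : List ColorRule, L.length ≤ shrinkTime x + 2 + 512 * D ∧
      Reduces.{u} D (2 ^ x) (D + 1) L := by
  obtain ⟨L₁, hL₁, hred₁⟩ := exists_linial_program.{u} hD hx
  -- The factor 128 makes `2 ^ (3 * Nat.clog 2 D + 18) ≤ (128 D)³ ≤ q³`; the upper bound `q ≤ 256 D`
  -- bounds the additive rounds and the removals together by `512 D`.
  obtain ⟨q, hq, hlt, hle⟩ := Nat.exists_prime_lt_and_le_two_mul (128 * D) (by positivity)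
  have : Fact q.Prime := ⟨hq⟩
  obtain ⟨F, hF⟩ := exists_linial_rule.{u} D q 3 (by omega)
  obtain ⟨L₂, hL₂, hred₂⟩ := exists_remove_colors.{u} D (q - (D + 1))
  rw [Nat.add_sub_cancel' (by omega)] at hred₂
  have hadd := reduces_additiveRule.{u} (D := D) (q := q) (by omega)
  refine ⟨L₁ ++ ([F] ++ (List.replicate q (additiveRule q) ++ L₂)), ?_,
    hred₁.append ((hF.mono ?_ le_rfl).append (hadd.append hred₂))⟩
  · simp only [List.length_append, List.length_replicate, List.length_singleton, hL₁, hL₂]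
    omega
  · have h1 : 2 ^ Nat.clog 2 D ≤ 2 * D := by
      obtain h | h := Nat.lt_or_ge 1 D
      · have h2 := Nat.pow_pred_clog_lt_self (b := 2) (by norm_num) h
        have h3 := Nat.clog_pos (b := 2) (by norm_num) h
        rw [← Nat.succ_pred_eq_of_pos h3, pow_succ]
        omega
      · rw [Nat.clog_of_right_le_one h]
        omega
    calc 2 ^ (3 * Nat.clog 2 D + 18) = (2 ^ Nat.clog 2 D * 64) ^ 3 := by
          rw [mul_pow, ← pow_mul, pow_add, mul_comm 3]
          norm_num
      _ ≤ q ^ 3 := Nat.pow_le_pow_left (by omega) _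

end Coloring

/-! ## Admissible partitions -/

section Partitions

lemma exists_isAdmissiblePartition {α : Type*} [DecidableEq α] {r k : ℕ} (hk : k < r)
    (s : Finset α) : ∃ P : Finpartition s, IsAdmissiblePartition r k s P := by
  unfold IsAdmissiblePartition
  split_ifs with h
  · have hm : numParts s.card ≠ 0 ∧ numParts s.card ≤ s.card ∧ s.card ≤ 5 * numParts s.card := by
      unfold numParts
      split_ifs <;> omega
    obtain ⟨P, hP, hcard⟩ := Finpartition.exists_equipartition_card_eq s hm.1 hm.2.1
    refine ⟨P, hcard, fun p hp => ?_⟩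
    have hav := hP.card_parts_eq_average hp
    rw [hcard] at hav
    have hpos := Nat.pos_of_ne_zero hm.1
    have hle5 : s.card / numParts s.card ≤ 5 := by
      have := (Nat.div_le_div_right (c := numParts s.card) hm.2.2)
      rwa [Nat.mul_div_cancel _ hpos] at this
    -- A part of size 6 forces average 5, hence all parts of size at least 5 and more than `5 *
    -- numParts` elements in total.
    by_contra! hcon
    have hq : s.card / numParts s.card = 5 := by omega
    have hp6 : p.card = 6 := by omega
    have hall : ∀ p ∈ P.parts, 5 ≤ p.card := fun p hp => by
      rcases hP.card_parts_eq_average hp with h | h <;> rw [hcard, hq] at h <;> omega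
    have hlt : ∑ _p ∈ P.parts, 5 < ∑ p ∈ P.parts, p.card :=
      Finset.sum_lt_sum hall ⟨p, hp, by omega⟩
    rw [P.sum_card_parts, Finset.sum_const, smul_eq_mul, hcard] at hlt
    omega
  · obtain rfl | hs := s.eq_empty_or_nonempty
    · exact ⟨Finpartition.empty _, fun p hp => by simp at hp⟩
    · exact ⟨Finpartition.indiscrete hs.ne_empty, fun p hp => by simpa using hp⟩

/-- An injective map pulls a partition of the image of `s` back to `s`. -/
lemma exists_finpartition_comap {α β : Type*} [DecidableEq α] [DecidableEq β] {g : α → β}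
    (hg : Function.Injective g) {s : Finset α} (Q : Finpartition (s.image g)) (r k : ℕ)
    (hQ : IsAdmissiblePartition r k (s.image g) Q) :
    ∃ P : Finpartition s, IsAdmissiblePartition r k s P ∧
      ∀ u v, (∃ p ∈ P.parts, u ∈ p ∧ v ∈ p) ↔ ∃ q ∈ Q.parts, g u ∈ q ∧ g v ∈ q := by
  set φ : Finset β → Finset α := fun q => s.filter fun u => g u ∈ q with hφ
  have himg : ∀ q ∈ Q.parts, (φ q).image g = q := by
    intro q hq
    ext b
    simp only [hφ, Finset.mem_image, Finset.mem_filter]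
    constructor
    · rintro ⟨a, ⟨-, ha⟩, rfl⟩
      exact ha
    · intro hb
      obtain ⟨a, ha, rfl⟩ := Finset.mem_image.1 (Q.le hq hb)
      exact ⟨a, ⟨ha, hb⟩, rfl⟩
  have hcard : ∀ q ∈ Q.parts, (φ q).card = q.card := fun q hq => by
    conv_rhs => rw [← himg q hq]
    exact (Finset.card_image_of_injective _ hg).symm
  have hinj : Set.InjOn φ Q.parts := fun q hq q' hq' h => by
    rw [← himg q hq, ← himg q' hq', h]
  have hmem : ∀ q ∈ Q.parts, ∀ u, u ∈ φ q ↔ g u ∈ q := by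
    intro q hq u
    simp only [hφ, Finset.mem_filter, and_iff_right_iff_imp]
    intro hu
    obtain ⟨a, ha, hau⟩ := Finset.mem_image.1 (Q.le hq hu)
    exact hg hau ▸ ha
  refine ⟨Finpartition.ofExistsUnique (Q.parts.image φ) ?_ ?_ ?_, ?_, fun u v => ?_⟩
  · intro p hp
    obtain ⟨q, -, rfl⟩ := Finset.mem_image.1 hp
    exact Finset.filter_subset _ _
  · intro a ha
    have hga : g a ∈ s.image g := Finset.mem_image_of_mem g ha
    refine ⟨φ (Q.part (g a)), ⟨Finset.mem_image_of_mem _ (Q.part_mem.2 hga),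
      (hmem _ (Q.part_mem.2 hga) a).2 (Q.mem_part hga)⟩, ?_⟩
    rintro p ⟨hp, hap⟩
    obtain ⟨q, hq, rfl⟩ := Finset.mem_image.1 hp
    rw [Q.part_eq_of_mem hq ((hmem q hq a).1 hap)]
  · intro h
    obtain ⟨q, hq, hq0⟩ := Finset.mem_image.1 h
    have := himg q hq
    rw [hq0, Finset.image_empty] at this
    rw [← this] at hq
    exact Q.bot_notMem hq
  · unfold IsAdmissiblePartition at hQ ⊢
    rw [Finset.card_image_of_injective _ hg] at hQ
    simp only [Finpartition.ofExistsUnique, Finset.forall_mem_image]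
    split_ifs at hQ ⊢ with h
    · exact ⟨(Finset.card_image_of_injOn hinj).trans hQ.1, fun q hq =>
        (hcard q hq).trans_le (hQ.2 q hq)⟩
    · intro q hq
      apply Finset.image_injective hg
      rw [himg q hq, hQ q hq]
  · simp only [Finpartition.ofExistsUnique, Finset.mem_image]
    constructor
    · rintro ⟨p, ⟨q, hq, rfl⟩, hu, hv⟩
      exact ⟨q, hq, (hmem q hq u).1 hu, (hmem q hq v).1 hv⟩
    · rintro ⟨q, hq, hu, hv⟩
      exact ⟨φ q, ⟨q, hq, rfl⟩, (hmem q hq u).2 hu, (hmem q hq v).2 hv⟩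

/-- Two identifiers lie in a common part of the canonical admissible partition of `s`. -/
def SamePart (r k : ℕ) (s : Finset ℕ) (i j : ℕ) : Prop :=
  if h : k < r then ∃ q ∈ (exists_isAdmissiblePartition h s).choose.parts, i ∈ q ∧ j ∈ q else False

/-- Vertices know only identifiers. Fixing one partition for each set of identifiers lets all
vertices of an edge agree without communication; pulling it back along `g` gives the partition of
vertices that `Iteration` asks for. -/
lemma exists_finpartition_samePart {α : Type*} [DecidableEq α] {g : α → ℕ}
    (hg : Function.Injective g) {r k : ℕ} (hk : k < r) (s : Finset α) :
    ∃ P : Finpartition s, IsAdmissiblePartition r k s P ∧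
      ∀ u v, (∃ p ∈ P.parts, u ∈ p ∧ v ∈ p) ↔ SamePart r k (s.image g) (g u) (g v) := by
  obtain ⟨P, hP, hP'⟩ := exists_finpartition_comap hg
    (exists_isAdmissiblePartition hk (s.image g)).choose r k
    (exists_isAdmissiblePartition hk (s.image g)).choose_spec
  refine ⟨P, hP, fun u v => (hP' u v).trans ?_⟩
  rw [SamePart, dif_pos hk]

/-- The graph in which two vertices are adjacent if they lie in a common part. -/
def partGraph {V : Type u} [Fintype V] [DecidableEq V] (H : Hypergraph V) (A : Finset V)
    (P : (e : Finset V) → Finpartition (A ∩ e)) : SimpleGraph V where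
  Adj v u := u ≠ v ∧ (partHypergraph H A P).Adj v u
  symm := ⟨fun _ _ h => ⟨h.1.symm, h.2.symm⟩⟩
  loopless := ⟨fun _ h => h.1 rfl⟩

lemma partHypergraph_adj {V : Type u} [Fintype V] [DecidableEq V] {H : Hypergraph V}
    {A : Finset V} {P : (e : Finset V) → Finpartition (A ∩ e)} {v u : V} :
    (partHypergraph H A P).Adj v u ↔
      ∃ e ∈ incidentEdges H v, u ∈ e ∧ ∃ q ∈ (P e).parts, v ∈ q ∧ u ∈ q := by
  constructor
  · rintro ⟨p, ⟨e, he, q, hq, rfl⟩, hv, hu⟩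
    have hle := (P e).le hq
    exact ⟨e, mem_incidentEdges.2 ⟨he, (Finset.mem_inter.1 (hle hv)).2⟩,
      (Finset.mem_inter.1 (hle hu)).2, q, hq, hv, hu⟩
  · rintro ⟨e, he, -, q, hq, hv, hu⟩
    exact ⟨q, ⟨e, (mem_incidentEdges.1 he).1, q, hq, rfl⟩, hv, hu⟩

/-- An incident edge contributes only the part containing `v`, minus `v`: at most 4 vertices if the
edge is split, and fewer than `4 (r - k)` otherwise. The degree is thus one less than the number of
available colours. -/
lemma ncard_neighborSet_partGraph_le {V : Type u} [Fintype V] [DecidableEq V] {H : Hypergraph V}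
    {Δ r k : ℕ} (hΔ : MaxDegreeLE H Δ) (hk : k < r) {A : Finset V}
    {P : (e : Finset V) → Finpartition (A ∩ e)}
    (hP : ∀ e ∈ edges H, IsAdmissiblePartition r k (A ∩ e) (P e)) (v : V) :
    ((partGraph H A P).neighborSet v).ncard ≤ 4 * Δ * (r - k) := by
  set T : Finset V → Finset V := fun e =>
    Finset.univ.filter fun u => u ≠ v ∧ ∃ q ∈ (P e).parts, v ∈ q ∧ u ∈ q with hT
  have hcard : ∀ e ∈ incidentEdges H v, (T e).card ≤ 4 * (r - k) := by
    intro e he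
    obtain h0 | ⟨w, hw⟩ := (T e).eq_empty_or_nonempty
    · simp [h0]
    · obtain ⟨-, -, q, hq, hvq, -⟩ := Finset.mem_filter.1 hw
      have hsub : T e ⊆ q.erase v := by
        intro u hu
        obtain ⟨-, huv, q', hq', hv', hu'⟩ := Finset.mem_filter.1 hu
        rw [(P e).eq_of_mem_parts hq hq' hvq hv']
        exact Finset.mem_erase.2 ⟨huv, hu'⟩
      have h1 := Finset.card_le_card hsub
      rw [Finset.card_erase_of_mem hvq] at h1
      have hadm := hP e (mem_incidentEdges.1 he).1
      unfold IsAdmissiblePartition at hadm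
      split_ifs at hadm with h
      · have := hadm.2 q hq
        omega
      · rw [hadm q hq] at h1
        omega
  have hsub : (partGraph H A P).neighborSet v ⊆ ((incidentEdges H v).biUnion T : Finset V) := by
    rintro u ⟨huv, hadj⟩
    obtain ⟨e, he, -, hq⟩ := partHypergraph_adj.1 hadj
    exact Finset.mem_coe.2 (Finset.mem_biUnion.2
      ⟨e, he, Finset.mem_filter.2 ⟨Finset.mem_univ _, huv, hq⟩⟩)
  refine (Set.ncard_le_ncard hsub (Set.toFinite _)).trans ?_
  rw [Set.ncard_coe_finset]
  refine (Finset.card_biUnion_le_card_mul _ _ _ hcard).trans ?_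
  calc (incidentEdges H v).card * (4 * (r - k)) ≤ Δ * (4 * (r - k)) :=
        Nat.mul_le_mul_right _ (hΔ v)
    _ = 4 * Δ * (r - k) := by ring

/-- The graph in which two vertices are adjacent if they share an edge of the hypergraph. -/
def edgeGraph {V : Type u} (H : Hypergraph V) : SimpleGraph V where
  Adj v u := u ≠ v ∧ H.Adj u v
  symm := ⟨fun _ _ h => ⟨h.1.symm, h.2.symm⟩⟩
  loopless := ⟨fun _ h => h.1 rfl⟩

/-- This is why one colouring computed before the main loop can start the colour reduction of every
iteration. -/
lemma partGraph_le_edgeGraph {V : Type u} [Fintype V] [DecidableEq V] (H : Hypergraph V)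
    (A : Finset V) (P : (e : Finset V) → Finpartition (A ∩ e)) :
    partGraph H A P ≤ edgeGraph H := by
  rintro v u ⟨huv, hadj⟩
  obtain ⟨e, he, hu, -⟩ := partHypergraph_adj.1 hadj
  obtain ⟨he, hv⟩ := mem_incidentEdges.1 he
  exact ⟨huv, (e : Set V), mem_edges.1 he, hu, hv⟩

lemma ncard_neighborSet_edgeGraph_le {V : Type u} [Fintype V] [DecidableEq V] {H : Hypergraph V}
    {Δ r : ℕ} (hΔ : MaxDegreeLE H Δ) (hr : IsUniform H r) (v : V) :
    ((edgeGraph H).neighborSet v).ncard ≤ Δ * r := by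
  have hsub : (edgeGraph H).neighborSet v ⊆ ((incidentEdges H v).biUnion id : Finset V) := by
    rintro u ⟨-, e, he, hu, hv⟩
    refine Finset.mem_coe.2 (Finset.mem_biUnion.2 ⟨e.toFinset, mem_incidentEdges.2
      ⟨mem_edges.2 (by simpa using he), by simpa using hv⟩, by simpa using hu⟩)
  refine (Set.ncard_le_ncard hsub (Set.toFinite _)).trans ?_
  rw [Set.ncard_coe_finset]
  refine (Finset.card_biUnion_le_card_mul _ _ r fun e he =>
    (hr e (mem_incidentEdges.1 he).1).le).trans (Nat.mul_le_mul_right _ (hΔ v))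

end Partitions

/-! ## Programs for the LOCAL model -/

/-- The memory of a vertex during the distributed execution of kWeakMIS. -/
structure Memory where
  /-- own identifier -/
  ident : ℕ
  /-- incident edges, as sets of identifiers -/
  inc : Finset (Finset ℕ)
  /-- the vertex has joined the independent set -/
  joined : Prop
  /-- the vertex is active -/
  active : Prop
  /-- colour computed before the main loop -/
  base : ℕ
  /-- current colour -/
  color : ℕ
  /-- identifiers of the vertices whose colours are taken into account when recolouring -/
  nbrs : Set ℕ

/-- One round: the new memory is computed from the old one and the memories of all neighbours,
tagged with their identifiers. -/
abbrev Round : Type := Memory → Set (ℕ × Memory) → Memory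

/-- The LOCAL algorithm that executes the rounds of a list; every vertex sends its complete memory
in every round. -/
def programAlgorithm (prog : Params → List Round)
    (start : Params → ℕ → Finset (Finset ℕ) → Memory) : LocalAlgorithm Bool where
  State := List Round × Memory
  Msg := Memory
  init p i E := (prog p, start p i E)
  send s _ := s.2
  recv s M := (s.1.tail, (s.1.head?.getD fun x _ => x) s.2 M)
  output s := decide s.2.joined
  rounds p := (prog p).length

section Programs

variable {V : Type u} [Fintype V] [DecidableEq V] {H : Hypergraph V} {ident : V → ℕ}

/-- The finite set of all vertices with the property `p`. -/
def collect {V : Type u} [Fintype V] (p : V → Prop) : Finset V := Finset.univ.filter p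

lemma mem_collect {V : Type u} [Fintype V] {p : V → Prop} {v : V} : v ∈ collect p ↔ p v := by
  simp [collect]

/-- The messages that `v` receives if every vertex sends its memory. -/
def inbox {V : Type u} (H : Hypergraph V) (ident : V → ℕ) (x : V → Memory) (v : V) :
    Set (ℕ × Memory) :=
  {m | ∃ u, u ≠ v ∧ H.Adj u v ∧ m = (ident u, x u)}

/-- The effect of one round on the memories of all vertices. -/
def runRound {V : Type u} (H : Hypergraph V) (ident : V → ℕ) (x : V → Memory) (R : Round) :
    V → Memory :=
  fun v => R (x v) (inbox H ident x v)

lemma state_programAlgorithm (prog : Params → List Round)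
    (start : Params → ℕ → Finset (Finset ℕ) → Memory) (p : Params) (H : Hypergraph V)
    (ident : V → ℕ) (t : ℕ) (ht : t ≤ (prog p).length) (v : V) :
    (programAlgorithm prog start).state p H ident t v =
      ((prog p).drop t, ((prog p).take t).foldl (runRound H ident)
        (fun v => start p (ident v) ((incidentEdges H v).image fun e => e.image ident)) v) := by
  induction t generalizing v with
  | zero => rfl
  | succ t ih =>
    have ht' : t < (prog p).length := ht
    have hstate : (programAlgorithm prog start).state p H ident (t + 1) v =
      (programAlgorithm prog start).recv ((programAlgorithm prog start).state p H ident t v)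
        {y | ∃ u, u ≠ v ∧ H.Adj u v ∧ y = (ident u, (programAlgorithm prog start).send
          ((programAlgorithm prog start).state p H ident t u) (ident v))} := rfl
    rw [hstate]
    simp only [ih ht'.le, List.take_succ_eq_append_getElem ht', List.foldl_append]
    simp [programAlgorithm, ht', runRound, inbox]

lemma selectedSet_programAlgorithm (prog : Params → List Round)
    (start : Params → ℕ → Finset (Finset ℕ) → Memory) (p : Params) (H : Hypergraph V)
    (ident : V → ℕ) :
    selectedSet (programAlgorithm prog start) p H ident =
      collect fun v => ((prog p).foldl (runRound H ident)
        (fun v => start p (ident v) ((incidentEdges H v).image fun e => e.image ident)) v).joined := by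
  ext v
  have h := state_programAlgorithm prog start p H ident (prog p).length le_rfl v
  rw [List.take_length] at h
  have hres : (programAlgorithm prog start).result p H ident v = (programAlgorithm prog start).output
    ((programAlgorithm prog start).state p H ident (prog p).length v) := rfl
  rw [selectedSet, Finset.mem_filter, mem_collect, hres, h]
  simp [programAlgorithm]

/-- The memories record the identifiers and the incident edges. -/
def IsFaithful (H : Hypergraph V) (ident : V → ℕ) (x : V → Memory) : Prop :=
  ∀ v, (x v).ident = ident v ∧
    (x v).inc = (incidentEdges H v).image fun e => e.image ident

/-- The vertex with identifier `i`, which is the vertex with memory `x` itself or one of the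
senders of the messages `M`, has the property `p`. -/
def Memory.Holds (x : Memory) (M : Set (ℕ × Memory)) (p : Memory → Prop) (i : ℕ) : Prop :=
  (i = x.ident ∧ p x) ∨ ∃ y, (i, y) ∈ M ∧ p y

/-- Any vertex of an incident edge is either `v` itself, which gets no message from itself, or a
sender; injective identifiers make the lookup unambiguous. -/
lemma holds_iff (hinj : Function.Injective ident) {x : V → Memory} (hx : IsFaithful H ident x)
    (p : Memory → Prop) {v u : V} {e : Finset V} (he : e ∈ incidentEdges H v) (hu : u ∈ e) :
    (x v).Holds (inbox H ident x v) p (ident u) ↔ p (x u) := by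
  unfold Memory.Holds
  rw [(hx v).1]
  constructor
  · rintro (⟨h, hp⟩ | ⟨y, ⟨w, -, -, hw⟩, hp⟩)
    · rwa [hinj h]
    · obtain ⟨h1, rfl⟩ := Prod.mk.inj hw
      rwa [hinj h1]
  · intro hp
    by_cases huv : u = v
    · subst huv
      exact Or.inl ⟨rfl, hp⟩
    · obtain ⟨heE, hv⟩ := mem_incidentEdges.1 he
      exact Or.inr ⟨x u, ⟨u, huv, ⟨(e : Set V), mem_edges.1 heE, hu, hv⟩, rfl⟩, hp⟩

lemma filter_holds (hinj : Function.Injective ident) {x : V → Memory}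
    (hx : IsFaithful H ident x) (p : Memory → Prop) {v : V} {e : Finset V}
    (he : e ∈ incidentEdges H v) :
    (e.image ident).filter ((x v).Holds (inbox H ident x v) p) =
      ((collect fun u => p (x u)) ∩ e).image ident := by
  ext i
  simp only [Finset.mem_filter, Finset.mem_image, Finset.mem_inter, mem_collect]
  constructor
  · rintro ⟨⟨u, hu, rfl⟩, h⟩
    exact ⟨u, ⟨(holds_iff hinj hx p he hu).1 h, hu⟩, rfl⟩
  · rintro ⟨u, ⟨hp, hu⟩, rfl⟩
    exact ⟨⟨u, hu, rfl⟩, (holds_iff hinj hx p he hu).2 hp⟩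

lemma card_filter_holds (hinj : Function.Injective ident) {x : V → Memory}
    (hx : IsFaithful H ident x) (p : Memory → Prop) {v : V} {e : Finset V}
    (he : e ∈ incidentEdges H v) :
    ((e.image ident).filter ((x v).Holds (inbox H ident x v) p)).card =
      ((collect fun u => p (x u)) ∩ e).card := by
  rw [filter_holds hinj hx p he, Finset.card_image_of_injective _ hinj]

/-! ### The rounds of kWeakMIS -/

/-- Recolouring with the rule `F`, where only the colours of the vertices in `nbrs` are seen. -/
def recolorRound (F : ColorRule) : Round := fun x M =>
  { x with color := F x.color {c | ∃ m ∈ M, m.1 ∈ x.nbrs ∧ m.2.color = c} }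

/-- The current colour becomes the base colour. -/
def saveRound : Round := fun x _ => { x with base := x.color }

/-- Partition the active vertices of the incident edges and return to the base colour. -/
def partitionRound (r k : ℕ) : Round := fun x M =>
  { x with
    color := x.base
    nbrs := {i | ∃ e ∈ x.inc, SamePart r k (e.filter (x.Holds M Memory.active)) x.ident i} }

/-- Process the colour `j`. -/
def joinRound (k j : ℕ) : Round := fun x M =>
  { x with joined := x.joined ∨ (x.active ∧ x.color = j) ∧ ∀ e ∈ x.inc,
      (e.filter (x.Holds M fun y => y.active ∧ y.color = j)).card +
        (e.filter (x.Holds M Memory.joined)).card ≤ k }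

/-- Update the set of active vertices. -/
def deactivateRound (k : ℕ) : Round := fun x M =>
  { x with active := (x.active ∧ ¬ x.joined) ∧
      ∀ e ∈ x.inc, (e.filter (x.Holds M Memory.joined)).card ≠ k }

/-- One iteration of the main loop, where `L` are the recolouring rules. -/
def iterationRounds (Δ r k : ℕ) (L : List ColorRule) : List Round :=
  [partitionRound r k] ++ (L.map recolorRound ++
    ((List.range (4 * Δ * (r - k) + 1)).map (joinRound k) ++ [deactivateRound k]))

/-- The field `nbrs` acts as a filter on messages, so the same round simulates recolouring on any
subgraph of the communication graph. Recolouring leaves `nbrs` unchanged, so the hypothesis survives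
the induction. -/
lemma foldl_recolorRound {V : Type u} {H : Hypergraph V} {ident : V → ℕ} {G : SimpleGraph V}
    (L : List ColorRule) (x : V → Memory)
    (hG : ∀ v u, G.Adj v u ↔ u ≠ v ∧ H.Adj u v ∧ ident u ∈ (x v).nbrs) :
    (L.map recolorRound).foldl (runRound H ident) x =
      fun v => { x v with color := runColors G L (fun v => (x v).color) v } := by
  induction L generalizing x with
  | nil => rfl
  | cons F L ih =>
    have hstep : runRound H ident x (recolorRound F) =
        fun v => { x v with color := recolor G F (fun v => (x v).color) v } := by
      funext v
      have : {c | ∃ m ∈ inbox H ident x v, m.1 ∈ (x v).nbrs ∧ m.2.color = c} =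
          (fun v => (x v).color) '' G.neighborSet v := by
        ext c
        constructor
        · rintro ⟨_, ⟨u, h1, h2, rfl⟩, h3, rfl⟩
          exact ⟨u, (hG v u).2 ⟨h1, h2, h3⟩, rfl⟩
        · rintro ⟨u, hu, rfl⟩
          obtain ⟨h1, h2, h3⟩ := (hG v u).1 hu
          exact ⟨_, ⟨u, h1, h2, rfl⟩, h3, rfl⟩
      simp only [runRound, recolorRound, recolor, this]
    rw [List.map_cons, List.foldl_cons, hstep]
    exact ih _ hG

lemma foldl_joinRound (hinj : Function.Injective ident) {x : V → Memory}
    (hx : IsFaithful H ident x) (k : ℕ) {m : ℕ} {f : V → Fin m}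
    (hf : ∀ v, (f v : ℕ) = (x v).color) (j : ℕ) :
    ((List.range j).map (joinRound k)).foldl (runRound H ident) x =
      fun v => { x v with joined := (v ∈ afterColors H k
        (collect fun v => (x v).active) f
        (collect fun v => (x v).joined) j) } := by
  induction j with
  | zero =>
    funext v
    simp [afterColors, mem_collect]
  | succ j ih =>
    rw [List.range_succ, List.map_append, List.foldl_append, ih]
    set A := collect fun v => (x v).active with hA
    set T := afterColors H k A f (collect fun v => (x v).joined) j with hT
    set y : V → Memory := fun v => { x v with joined := v ∈ T } with hy
    have hy' : IsFaithful H ident y := hx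
    funext v
    have hVc : (collect fun u => (y u).active ∧ (y u).color = j) =
        A.filter fun v => (f v : ℕ) = j := by
      ext u
      simp [hy, hA, hf, mem_collect]
    have hTy : (collect fun u => (y u).joined) = T := by
      ext u
      simp [hy, mem_collect]
    have hcond : (∀ e ∈ (y v).inc,
        (e.filter ((y v).Holds (inbox H ident y v) fun z => z.active ∧ z.color = j)).card +
          (e.filter ((y v).Holds (inbox H ident y v) Memory.joined)).card ≤ k) ↔
        ∀ e ∈ incidentEdges H v,
          ((A.filter fun v => (f v : ℕ) = j) ∩ e).card + sat T e ≤ k := by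
      rw [(hy' v).2, Finset.forall_mem_image]
      refine forall₂_congr fun e he => ?_
      rw [card_filter_holds hinj hy' _ he, card_filter_holds hinj hy' _ he, hVc, hTy, sat,
        Finset.inter_comm T e]
    have hnew : ((y v).joined ∨ ((y v).active ∧ (y v).color = j) ∧ ∀ e ∈ (y v).inc,
        (e.filter ((y v).Holds (inbox H ident y v) fun z => z.active ∧ z.color = j)).card +
          (e.filter ((y v).Holds (inbox H ident y v) Memory.joined)).card ≤ k) =
        (v ∈ afterColors H k A f (collect fun v => (x v).joined) (j + 1)) := by
      rw [hcond, afterColors, ← hT, colorStep, Finset.mem_union, Finset.mem_filter,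
        Finset.mem_filter, hf]
      simp [hy, hA, mem_collect]
    simp only [List.map_cons, List.map_nil, List.foldl_cons, List.foldl_nil, runRound, joinRound]
    rw [hnew]

lemma runRound_deactivateRound (hinj : Function.Injective ident) {x : V → Memory}
    (hx : IsFaithful H ident x) (k : ℕ) :
    runRound H ident x (deactivateRound k) = fun v => { x v with
      active := (v ∈ ((collect fun v => (x v).active) \
        (collect fun v => (x v).joined)).filter fun v => ∀ e ∈ incidentEdges H v,
          sat (collect fun v => (x v).joined) e ≠ k) } := by
  funext v
  have hcond : (∀ e ∈ (x v).inc,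
      (e.filter ((x v).Holds (inbox H ident x v) Memory.joined)).card ≠ k) ↔
      ∀ e ∈ incidentEdges H v, sat (collect fun v => (x v).joined) e ≠ k := by
    rw [(hx v).2, Finset.forall_mem_image]
    refine forall₂_congr fun e he => ?_
    rw [card_filter_holds hinj hx _ he, sat, Finset.inter_comm]
  simp only [runRound, deactivateRound]
  rw [hcond]
  simp [mem_collect]

/-- The base colours form a proper colouring with `M` colours of the graph of all pairs of vertices
that share an edge. -/
def HasBaseColoring {V : Type u} (H : Hypergraph V) (M : ℕ) (x : V → Memory) : Prop :=
  IsColoringLT (edgeGraph H) M fun v => (x v).base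

/-- The memories after each block of rounds are matched with the objects of the abstract iteration:
partitions and colouring, then the set after all colours, then the new active set. Base colours and
edges are never overwritten, so iterations can be chained. -/
lemma foldl_iterationRounds (hinj : Function.Injective ident) {Δ r k M : ℕ} (hk : k < r)
    (hΔ : MaxDegreeLE H Δ) {L : List ColorRule}
    (hL : Reduces.{u} (4 * Δ * (r - k)) M (4 * Δ * (r - k) + 1) L) {x : V → Memory}
    (hx : IsFaithful H ident x) (hbase : HasBaseColoring H M x) :
    IsFaithful H ident ((iterationRounds Δ r k L).foldl (runRound H ident) x) ∧
    HasBaseColoring H M ((iterationRounds Δ r k L).foldl (runRound H ident) x) ∧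
    Iteration H Δ r k
      (collect fun v => (x v).joined, collect fun v => (x v).active)
      (collect fun v =>
        ((iterationRounds Δ r k L).foldl (runRound H ident) x v).joined,
       collect fun v =>
        ((iterationRounds Δ r k L).foldl (runRound H ident) x v).active) := by
  set A := collect fun v => (x v).active with hA
  choose P hP hP' using fun e : Finset V => exists_finpartition_samePart hinj hk (A ∩ e)
  set G := partGraph H A P with hG
  have hdeg := ncard_neighborSet_partGraph_le hΔ hk (P := P) fun e _ => hP e
  have hstart : IsColoringLT G M fun v => (x v).base :=
    ⟨fun u v huv => hbase.1 u v (partGraph_le_edgeGraph H A P huv), hbase.2⟩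
  have hcol := hL V G _ hdeg hstart
  set c := runColors G L fun v => (x v).base with hc
  set y : V → Memory := runRound H ident x (partitionRound r k) with hy
  have hGy : ∀ v u, G.Adj v u ↔ u ≠ v ∧ H.Adj u v ∧ ident u ∈ (y v).nbrs := by
    intro v u
    have hnbr : ident u ∈ (y v).nbrs ↔ (partHypergraph H A P).Adj v u := by
      have : ident u ∈ (y v).nbrs ↔ ∃ e ∈ (x v).inc, SamePart r k
          (e.filter ((x v).Holds (inbox H ident x v) Memory.active)) (x v).ident (ident u) := Iff.rfl
      rw [this, partHypergraph_adj, (hx v).2, (hx v).1]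
      simp only [Finset.exists_mem_image]
      refine exists_congr fun e => and_congr_right fun he => ?_
      rw [filter_holds hinj hx _ he, ← hP' e v u]
      refine ⟨fun ⟨q, hq, hv, hu⟩ => ⟨?_, q, hq, hv, hu⟩, fun h => h.2⟩
      exact (Finset.mem_inter.1 ((P e).le hq hu)).2
    rw [hnbr]
    exact ⟨fun h => ⟨h.1, (partGraph_le_edgeGraph H A P h).2, h.2⟩, fun h => ⟨h.1, h.2.2⟩⟩
  set z : V → Memory := fun v => { y v with color := c v } with hz
  have hzx : IsFaithful H ident z := hx
  set f : V → Fin (4 * Δ * (r - k) + 1) := fun v => ⟨c v, hcol.2 v⟩ with hf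
  set S' := afterColors H k A f (collect fun v => (x v).joined)
    (4 * Δ * (r - k) + 1) with hS'
  set w : V → Memory := fun v => { z v with joined := v ∈ S' } with hw
  have hwx : IsFaithful H ident w := hx
  have hSw : (collect fun v => (w v).joined) = S' := by
    ext v
    simp [hw, mem_collect]
  set A' := (A \ S').filter fun v => ∀ e ∈ incidentEdges H v, sat S' e ≠ k with hA'
  have hrun : (iterationRounds Δ r k L).foldl (runRound H ident) x =
      fun v => { w v with active := v ∈ A' } := by
    rw [iterationRounds, List.foldl_append, List.foldl_append, List.foldl_append]
    simp only [List.foldl_cons, List.foldl_nil]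
    rw [← hy, foldl_recolorRound (G := G) L y hGy]
    have h1 : (fun v => { y v with color := runColors G L (fun v => (y v).color) v }) = z := rfl
    rw [h1, foldl_joinRound hinj hzx k (f := f) fun v => rfl]
    have h2 : (fun v => { z v with joined := (v ∈ afterColors H k
        (collect fun v => (z v).active) f
        (collect fun v => (z v).joined) (4 * Δ * (r - k) + 1)) }) = w := rfl
    rw [h2, runRound_deactivateRound hinj hwx, hSw]
    rfl
  rw [hrun]
  refine ⟨hx, hbase, P, f, fun e _ => hP e, fun u v huv hadj h => ?_, hSw, ?_⟩
  · exact hcol.1 u v ⟨huv.symm, hadj⟩ (congrArg Fin.val h)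
  · change (collect fun v => v ∈ A') =
      (A \ (collect fun v => (w v).joined)).filter fun v =>
        ∀ e ∈ incidentEdges H v, sat (collect fun v => (w v).joined) e ≠ k
    rw [hSw]
    ext v
    simp [hA', mem_collect]

/-- If `H` has no edges, then a single iteration selects all vertices. -/
lemma isOutputOfKWeakMIS_univ {r k : ℕ} (hr : IsUniform H r) (hk : k < r)
    (hΔ : MaxDegreeLE H 0) : IsOutputOfKWeakMIS H 0 r k Finset.univ := by
  have hinc : ∀ v, incidentEdges H v = ∅ := fun v =>
    Finset.card_eq_zero.1 (Nat.le_zero.1 (hΔ v))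
  have hedges : edges H = ∅ := by
    by_contra hne
    obtain ⟨e, he⟩ := Finset.nonempty_iff_ne_empty.2 hne
    obtain ⟨v, hv⟩ := Finset.card_pos.1 (show 0 < e.card by rw [hr e he]; omega)
    have := mem_incidentEdges.2 ⟨he, hv⟩
    rw [hinc v] at this
    simp at this
  have hN : numIterations 0 r = 1 := by simp [numIterations]
  refine ⟨fun i => if i = 0 then (∅, Finset.univ) else (Finset.univ, ∅), rfl, fun i hi => ?_, ?_⟩
  · rw [hN] at hi
    obtain rfl : i = 0 := by omega
    choose P hP using fun e : Finset V =>
      exists_isAdmissiblePartition hk ((Finset.univ : Finset V) ∩ e)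
    refine ⟨P, fun _ => 0, fun e _ => hP e, ?_, ?_, ?_⟩
    · rintro u v - ⟨p, ⟨e, he, -⟩, -⟩
      rw [hedges] at he
      simp at he
    · have : 4 * 0 * (r - k) + 1 = 1 := by omega
      simp only [this]
      ext v
      simp [afterColors, colorStep, hinc]
    · simp
  · simp [hN]

/-- The rounds that are executed for the parameters `p`, where `lin D x` reduces `2 ^ x` colours to
`O(D³)` and `col D x` reduces them to `D + 1`. -/
def kWeakMISRounds (lin col : ℕ → ℕ → List ColorRule) (c : ℕ) (p : Params) : List Round :=
  if p.Δ = 0 then [] else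
    (lin (p.Δ * p.r) ((c + 1) * Nat.clog 2 p.n + (c + 1))).map recolorRound ++ ([saveRound] ++
      (List.replicate (numIterations p.Δ p.r) (iterationRounds p.Δ p.r p.k
        (col (4 * p.Δ * (p.r - p.k)) (3 * Nat.clog 2 (p.Δ * p.r) + 18)))).flatten)

/-- The initial memory of a vertex. -/
def startMemory (p : Params) (i : ℕ) (E : Finset (Finset ℕ)) : Memory where
  ident := i
  inc := E
  joined := p.Δ = 0
  active := True
  base := 0
  color := i
  nbrs := Set.univ

lemma isOutput_foldl_iterationRounds (hinj : Function.Injective ident) {Δ r k M : ℕ} (hk : k < r)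
    (hΔ : MaxDegreeLE H Δ) {L : List ColorRule}
    (hL : Reduces.{u} (4 * Δ * (r - k)) M (4 * Δ * (r - k) + 1) L) {x : V → Memory}
    (hx : IsFaithful H ident x) (hbase : HasBaseColoring H M x)
    (hjoined : ∀ v, ¬ (x v).joined) (hactive : ∀ v, (x v).active) :
    IsOutputOfKWeakMIS H Δ r k (collect fun v =>
      ((List.replicate (numIterations Δ r) (iterationRounds Δ r k L)).flatten.foldl
        (runRound H ident) x v).joined) := by
  set y : ℕ → V → Memory := fun i =>
    (List.replicate i (iterationRounds Δ r k L)).flatten.foldl (runRound H ident) x with hy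
  have hstep : ∀ i, y (i + 1) = (iterationRounds Δ r k L).foldl (runRound H ident) (y i) := by
    intro i
    simp only [hy]
    rw [List.replicate_succ', List.flatten_append, List.foldl_append]
    simp
  have hinv : ∀ i, IsFaithful H ident (y i) ∧ HasBaseColoring H M (y i) := by
    intro i
    induction i with
    | zero => exact ⟨hx, hbase⟩
    | succ i ih =>
      have := foldl_iterationRounds hinj hk hΔ hL ih.1 ih.2
      rw [hstep]
      exact ⟨this.1, this.2.1⟩
  refine ⟨fun i => (collect fun v => (y i v).joined,
    collect fun v => (y i v).active), ?_, fun i _ => ?_, rfl⟩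
  · simp only [hy, List.replicate_zero, List.flatten_nil, List.foldl_nil, Prod.mk.injEq]
    exact ⟨Finset.filter_false_of_mem fun v _ => hjoined v,
      Finset.filter_true_of_mem fun v _ => hactive v⟩
  · have := (foldl_iterationRounds hinj hk hΔ hL (hinv i).1 (hinv i).2).2.2
    rw [← hstep] at this
    exact this

lemma isOutput_selectedSet_kWeakMISRounds {lin col : ℕ → ℕ → List ColorRule}
    (hlin : ∀ D x, 1 ≤ D → 1 ≤ x →
      Reduces.{u} D (2 ^ x) (2 ^ (3 * Nat.clog 2 D + 18)) (lin D x))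
    (hcol : ∀ D x, 1 ≤ D → 1 ≤ x → Reduces.{u} D (2 ^ x) (D + 1) (col D x))
    (c : ℕ) {n Δ r k : ℕ} (hk : k < r) (hr : IsUniform H r) (hΔ : MaxDegreeLE H Δ)
    (hinj : Function.Injective ident) (hid : ∀ v, ident v ≤ n ^ c) :
    IsOutputOfKWeakMIS H Δ r k (selectedSet (programAlgorithm (kWeakMISRounds lin col c) startMemory)
      ⟨n, Δ, r, k⟩ H ident) := by
  rw [selectedSet_programAlgorithm]
  set x₀ : V → Memory := fun v => startMemory ⟨n, Δ, r, k⟩ (ident v)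
    ((incidentEdges H v).image fun e => e.image ident) with hx₀
  obtain rfl | hΔ0 := Nat.eq_zero_or_pos Δ
  · have : (collect fun v => ((kWeakMISRounds lin col c ⟨n, 0, r, k⟩).foldl
        (runRound H ident) x₀ v).joined) = Finset.univ := by
      simp [kWeakMISRounds, hx₀, startMemory, collect]
    rw [this]
    exact isOutputOfKWeakMIS_univ hr hk hΔ
  · have hDr : 1 ≤ Δ * r := Nat.mul_pos hΔ0 (by omega)
    have hD : 1 ≤ 4 * Δ * (r - k) := Nat.mul_pos (by omega) (by omega)
    have hstart : IsColoringLT (edgeGraph H) (2 ^ ((c + 1) * Nat.clog 2 n + (c + 1)))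
        fun v => (x₀ v).color := by
      refine ⟨fun u v huv h => huv.ne (hinj h), fun v => ?_⟩
      calc ident v ≤ n ^ c := hid v
        _ ≤ (2 ^ Nat.clog 2 n) ^ c :=
          Nat.pow_le_pow_left (Nat.le_pow_clog (by norm_num) _) _
        _ = 2 ^ (Nat.clog 2 n * c) := by rw [← pow_mul]
        -- Using `c + 1` in place of `c` gives the strict inequality and keeps the exponent
        -- positive.
        _ < _ := Nat.pow_lt_pow_right (by norm_num) (by nlinarith)
    have hrun := hlin (Δ * r) _ hDr (by omega) V (edgeGraph H) _
      (ncard_neighborSet_edgeGraph_le hΔ hr) hstart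
    have hprog : kWeakMISRounds lin col c ⟨n, Δ, r, k⟩ =
        (lin (Δ * r) ((c + 1) * Nat.clog 2 n + (c + 1))).map recolorRound ++ ([saveRound] ++
          (List.replicate (numIterations Δ r) (iterationRounds Δ r k
            (col (4 * Δ * (r - k)) (3 * Nat.clog 2 (Δ * r) + 18)))).flatten) :=
      if_neg hΔ0.ne'
    rw [hprog, List.foldl_append, List.foldl_append,
      foldl_recolorRound (G := edgeGraph H) _ x₀ fun v u =>
        ⟨fun h => ⟨h.1, h.2, Set.mem_univ _⟩, fun h => ⟨h.1, h.2.1⟩⟩]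
    exact isOutput_foldl_iterationRounds hinj hk hΔ (hcol _ _ hD (by omega))
      (fun v => ⟨rfl, rfl⟩) hrun (fun v => hΔ0.ne') fun v => trivial

end Programs

/-! ## The number of rounds -/

section Rounds

/-- For `Δ = 0` the program is empty. Otherwise `Δ² (r - k) log r ≥ 1` absorbs all additive
constants. -/
lemma length_kWeakMISRounds_le {lin col : ℕ → ℕ → List ColorRule} {c C₁ C₂ n Δ r k : ℕ}
    (hlin : ∀ D x, 1 ≤ D → 1 ≤ x → (lin D x).length = shrinkTime x + 1)
    (hcol : ∀ D x, 1 ≤ D → 1 ≤ x → (col D x).length ≤ shrinkTime x + 2 + 512 * D)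
    (h₁ : ∀ N : ℕ, shrinkTime ((c + 1) * Nat.clog 2 N + (c + 1)) ≤ logStar N + C₁)
    (h₂ : ∀ N : ℕ, shrinkTime (18 * Nat.clog 2 N + 18) ≤ logStar N + C₂) (hk : 1 ≤ k)
    (hkr : k < r) :
    ((kWeakMISRounds lin col c ⟨n, Δ, r, k⟩).length : ℝ) ≤
      (C₁ + 2 * C₂ + 4200 : ℕ) * ((Δ : ℝ) ^ 2 * ((r : ℝ) - (k : ℝ)) * Real.logb 2 r
        + (Δ : ℝ) * Real.logb 2 r * (logStar r : ℝ) + (logStar n : ℝ)) := by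
  have hlog : 1 ≤ Real.logb 2 r := by
    rw [Real.le_logb_iff_rpow_le (by norm_num) (by exact_mod_cast (by omega : 0 < r))]
    simpa using (by exact_mod_cast (by omega : 2 ≤ r) : (2 : ℝ) ≤ r)
  have hrk : (1 : ℝ) ≤ (r : ℝ) - k := by
    have : ((k + 1 : ℕ) : ℝ) ≤ r := by exact_mod_cast hkr
    push_cast at this
    linarith
  obtain rfl | hΔ := Nat.eq_zero_or_pos Δ
  · simp only [kWeakMISRounds, if_true, List.length_nil, Nat.cast_zero]
    positivity
  · have hD : 1 ≤ 4 * Δ * (r - k) := Nat.mul_pos (by omega) (by omega)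
    have hDr : 1 ≤ Δ * r := Nat.mul_pos hΔ (by omega)
    -- If `Δ` exceeds `r`, the crude bound `log* Δ ≤ Δ` is affordable, since each iteration spends
    -- order `Δ (r - k)` rounds anyway.
    have hshrink : shrinkTime (3 * Nat.clog 2 (Δ * r) + 18) ≤ logStar r + Δ + C₂ := by
      have hclog : Nat.clog 2 (Δ * r) ≤ 2 * Nat.clog 2 (max Δ r) := by
        refine Nat.clog_le_of_le_pow ?_
        rw [two_mul, pow_add]
        exact Nat.mul_le_mul ((le_max_left _ _).trans (Nat.le_pow_clog (by norm_num) _))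
          ((le_max_right _ _).trans (Nat.le_pow_clog (by norm_num) _))
      refine (shrinkTime_mono (show _ ≤ 18 * Nat.clog 2 (max Δ r) + 18 by omega)).trans
        ((h₂ _).trans ?_)
      have := logStar_natCast_le Δ
      rcases max_choice Δ r with h | h <;> rw [h] <;> omega
    have hiter : (iterationRounds Δ r k (col (4 * Δ * (r - k))
        (3 * Nat.clog 2 (Δ * r) + 18))).length ≤
        logStar r + Δ + C₂ + 5 + 513 * (4 * Δ * (r - k)) := by
      have := hcol (4 * Δ * (r - k)) (3 * Nat.clog 2 (Δ * r) + 18) hD (by omega)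
      simp only [iterationRounds, List.length_append, List.length_map, List.length_range,
        List.length_singleton]
      omega
    have hlen : (kWeakMISRounds lin col c ⟨n, Δ, r, k⟩).length ≤ logStar n + C₁ + 2 +
        numIterations Δ r * (logStar r + Δ + C₂ + 5 + 513 * (4 * Δ * (r - k))) := by
      have h3 := hlin (Δ * r) ((c + 1) * Nat.clog 2 n + (c + 1)) hDr (by omega)
      have h4 := h₁ n
      have h5 := Nat.mul_le_mul_left (numIterations Δ r) hiter
      simp only [kWeakMISRounds, if_neg hΔ.ne', List.length_append, List.length_map,
        List.length_singleton, List.length_flatten, List.map_replicate, List.sum_replicate,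
        smul_eq_mul]
      omega
    have hΔ1 : (1 : ℝ) ≤ Δ := by exact_mod_cast hΔ
    set X : ℝ := (Δ : ℝ) * Real.logb 2 r with hX
    set Y : ℝ := (Δ : ℝ) * ((r : ℝ) - k) with hY
    have hX1 : 1 ≤ X := one_le_mul_of_one_le_of_one_le hΔ1 hlog
    have hYΔ : (Δ : ℝ) ≤ Y := le_mul_of_one_le_right (by linarith) hrk
    have hN : (numIterations Δ r : ℝ) ≤ 2 * X := by
      have := Nat.floor_le (show 0 ≤ X by linarith)
      rw [numIterations]
      push_cast
      linarith
    have hlen' : ((kWeakMISRounds lin col c ⟨n, Δ, r, k⟩).length : ℝ) ≤ logStar n + C₁ + 2 +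
        numIterations Δ r * (logStar r + Δ + C₂ + 5 + 2052 * Y) := by
      refine (Nat.cast_le.2 hlen).trans_eq ?_
      push_cast [Nat.cast_sub hkr.le]
      rw [hY]
      ring
    have hls : (0 : ℝ) ≤ logStar r := Nat.cast_nonneg _
    have hln : (0 : ℝ) ≤ logStar n := Nat.cast_nonneg _
    have hC₁ : (0 : ℝ) ≤ C₁ := Nat.cast_nonneg _
    have hC₂ : (0 : ℝ) ≤ C₂ := Nat.cast_nonneg _
    have hinner : (logStar r + Δ + C₂ + 5 + 2052 * Y : ℝ) ≤ logStar r + (C₂ + 2058) * Y := by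
      nlinarith
    have hmul : (numIterations Δ r * (logStar r + Δ + C₂ + 5 + 2052 * Y) : ℝ) ≤
        2 * X * (logStar r + (C₂ + 2058) * Y) :=
      mul_le_mul hN hinner (by positivity) (by positivity)
    have hXY : 1 ≤ X * Y := one_le_mul_of_one_le_of_one_le hX1 (hΔ1.trans hYΔ)
    have hXl : 0 ≤ X * logStar r := by positivity
    have hgoal : (Δ : ℝ) ^ 2 * ((r : ℝ) - (k : ℝ)) * Real.logb 2 r = X * Y := by
      rw [hX, hY]
      ring
    rw [hgoal]
    push_cast
    nlinarith [mul_nonneg hC₁ hXl, mul_nonneg hC₂ hXl, mul_nonneg hC₁ hln, mul_nonneg hC₂ hln,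
      mul_nonneg hC₁ (sub_nonneg.2 hXY), mul_nonneg hC₂ (sub_nonneg.2 hXY)]

/-- kWeakMIS can be carried out in the LOCAL model within the claimed number of rounds. -/
theorem exists_localAlgorithm (c : ℕ) : ∃ (A : LocalAlgorithm Bool) (C : ℝ),
    ∀ n Δ r k : ℕ, 1 ≤ k → k < r →
      (A.rounds ⟨n, Δ, r, k⟩ : ℝ) ≤
        C * ((Δ : ℝ) ^ 2 * ((r : ℝ) - (k : ℝ)) * Real.logb 2 r
          + (Δ : ℝ) * Real.logb 2 r * (logStar r : ℝ) + (logStar n : ℝ)) ∧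
      ∀ (V : Type u) [Fintype V] [DecidableEq V] (H : Hypergraph V) (ident : V → ℕ),
        IsUniform H r → MaxDegreeLE H Δ → Function.Injective ident → (∀ v, ident v ≤ n ^ c) →
        IsOutputOfKWeakMIS H Δ r k (selectedSet A ⟨n, Δ, r, k⟩ H ident) := by
  -- The conditions on `D` and `x` sit inside the existential so that `choose` gives unconditional
  -- functions, with the empty program as default value.
  have hlin : ∀ D x, ∃ L : List ColorRule, 1 ≤ D → 1 ≤ x → L.length = shrinkTime x + 1 ∧
      Reduces.{u} D (2 ^ x) (2 ^ (3 * Nat.clog 2 D + 18)) L := by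
    intro D x
    by_cases h : 1 ≤ D ∧ 1 ≤ x
    · obtain ⟨L, hL⟩ := exists_linial_program.{u} h.1 h.2
      exact ⟨L, fun _ _ => hL⟩
    · exact ⟨[], fun h1 h2 => absurd ⟨h1, h2⟩ h⟩
  have hcol : ∀ D x, ∃ L : List ColorRule, 1 ≤ D → 1 ≤ x →
      L.length ≤ shrinkTime x + 2 + 512 * D ∧ Reduces.{u} D (2 ^ x) (D + 1) L := by
    intro D x
    by_cases h : 1 ≤ D ∧ 1 ≤ x
    · obtain ⟨L, hL⟩ := exists_coloring_program.{u} h.1 h.2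
      exact ⟨L, fun _ _ => hL⟩
    · exact ⟨[], fun h1 h2 => absurd ⟨h1, h2⟩ h⟩
  choose lin hlin using hlin
  choose col hcol using hcol
  obtain ⟨C₁, h₁⟩ := exists_shrinkTime_le_logStar (c + 1)
  obtain ⟨C₂, h₂⟩ := exists_shrinkTime_le_logStar 18
  refine ⟨programAlgorithm (kWeakMISRounds lin col c) startMemory, (C₁ + 2 * C₂ + 4200 : ℕ),
    fun n Δ r k hk hkr => ⟨?_, fun V _ _ H ident hr hΔ hinj hid => ?_⟩⟩
  · exact length_kWeakMISRounds_le (fun D x hD hx => (hlin D x hD hx).1)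
      (fun D x hD hx => (hcol D x hD hx).1) h₁ h₂ hk hkr
  · exact isOutput_selectedSet_kWeakMISRounds (fun D x hD hx => (hlin D x hD hx).2)
      (fun D x hD hx => (hcol D x hD hx).2) c hkr hr hΔ hinj hid

end Rounds

end

end WeakMIS

theorem theorem5 :
    -- correctness: every execution of kWeakMIS outputs a `k`-weak maximal independent set
    (∀ (V : Type*) [Fintype V] [DecidableEq V] (H : Hypergraph V) (Δ r k : ℕ) (S : Finset V),
      H.vertexSet = Set.univ → WeakMIS.IsUniform H r → WeakMIS.MaxDegreeLE H Δ → 1 ≤ k → k < r →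
      WeakMIS.IsOutputOfKWeakMIS H Δ r k S → WeakMIS.IsKWeakMIS H k S) ∧
    -- running time: kWeakMIS is carried out by a deterministic algorithm in the LOCAL model, with
    -- unique identifiers that are polynomially bounded in the number of vertices
    (∀ c : ℕ, ∃ (A : WeakMIS.LocalAlgorithm Bool) (C : ℝ), ∀ n Δ r k : ℕ, 1 ≤ k → k < r →
      (A.rounds ⟨n, Δ, r, k⟩ : ℝ) ≤
        C * ((Δ : ℝ) ^ 2 * ((r : ℝ) - (k : ℝ)) * Real.logb 2 r
          + (Δ : ℝ) * Real.logb 2 r * (WeakMIS.logStar r : ℝ) + (WeakMIS.logStar n : ℝ)) ∧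
      ∀ (V : Type*) [Fintype V] [DecidableEq V] (H : Hypergraph V) (ident : V → ℕ),
        H.vertexSet = Set.univ → Fintype.card V = n →
        WeakMIS.IsUniform H r → WeakMIS.MaxDegreeLE H Δ →
        Function.Injective ident → (∀ v, ident v ≤ n ^ c) →
        WeakMIS.IsOutputOfKWeakMIS H Δ r k (WeakMIS.selectedSet A ⟨n, Δ, r, k⟩ H ident) ∧
        WeakMIS.IsKWeakMIS H k (WeakMIS.selectedSet A ⟨n, Δ, r, k⟩ H ident)) := by
  refine ⟨fun V _ _ H Δ r k S _ hr hΔ _ hk hS => hS.isKWeakMIS hr hΔ hk, fun c => ?_⟩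
  obtain ⟨A, C, hA⟩ := WeakMIS.exists_localAlgorithm c
  refine ⟨A, C, fun n Δ r k hk hkr => ⟨(hA n Δ r k hk hkr).1,
    fun V _ _ H ident _ _ hr hΔ hinj hid => ?_⟩⟩
  have hout := (hA n Δ r k hk hkr).2 V H ident hr hΔ hinj hid
  exact ⟨hout, hout.isKWeakMIS hr hΔ hkr⟩
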